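/- Let $\mathcal X\subset\mathbb R^n$ and $\mathcal Y\subset\mathbb R^m$ be compact, and regard $\mathcal X\times\mathcal Y$ as a subset of $\mathbb R^{n+m}$ with its Euclidean norm. Fix $\sigma>0$, let $K(z,z')=\exp(-\sigma\|z-z'\|^2)$ be the Gaussian kernel, and let $K_1$ and $K_2$ be its restrictions to $\mathcal X\times\mathcal Y$ and to $\mathcal Y$ (viewed as $\{0\}\times\mathcal Y$). For a finite measure $\nu$ let $\mathfrak M_{K_i}(\nu)=\int (K_i)_z\,d\nu(z)$ (Bochner integral) be its kernel mean embedding in the reproducing kernel Hilbert space $\mathcal H(K_i)$, where $(K_i)_z=K_i(z,\cdot)$, and put $\|\nu-\nu'\|_{\tilde K_i}=\|\mathfrak M_{K_i}(\nu)-\mathfrak M_{K_i}(\nu')\|_{\mathcal H(K_i)}$. Let $\mathcal H=C_{Lip}(\mathcal X,\mathcal P(\mathcal Y))$ be the set of the maps $h:\mathcal X\to\mathcal P(\mathcal Y)$ (Markov kernels) that are Lipschitz for the Euclidean metric on $\mathcal X$ and the metric $\|\cdot-\cdot\|_{\tilde K_2}$ on the set $\mathcal P(\mathcal Y)$ of Borel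 probability measures. For $h\in\mathcal H$ let $\Gamma_h(x)=\delta_x\otimes h(x)$ and $(\Gamma_h)_*\nu=\int\Gamma_h(x)\,d\nu(x)$. A regular conditional probability measure for $\mu\in\mathcal P(\mathcal X\times\mathcal Y)$, with $\mathcal X$-marginal $\mu_{\mathcal X}$, is a Markov kernel $h$ with $\mu(A\times B)=\int_A h(x)(B)\,d\mu_{\mathcal X}(x)$ for all Borel $A\subset\mathcal X$, $B\subset\mathcal Y$. Let $\mathcal P_{Lip}$ be the set of all $\mu\in\mathcal P(\mathcal X\times\mathcal Y)$ such that $\mu_{\mathcal X}$ has support $\mathcal X$ and $\mu$ has a regular conditional probability measure in $\mathcal H$. For $h,f,f'\in\mathcal H$ define $$R(h,\mu)=\|(\Gamma_h)_*\mu_{\mathcal X}-\mu\|_{\tilde K_1},\qquad d_M(f,f')=\sup_{x\in\mathcal X}\big(\|f(x)-f'(x)\|_{\tilde K_2}+\|\Gamma_f(x)-\Gamma_{f'}(x)\|_{\tilde K_1}\big).$$ Then there are a sequence $C=(c_N)_{N\ge1}$ with $c_1\ge c_2\ge\dots\ge0$ and $c_N\to0$, a sequence $\Gamma=(\gamma_N)_{N\ge1}$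 with $\gamma_1>\gamma_2>\dots>0$ and $\gamma_N\to0$, and a learning algorithm $A:\bigcup_{N\ge1}(\mathcal X\times\mathcal Y)^N\to\mathcal H$ (no measurability required) with the following properties. 1. $A$ is a $(C,\Gamma)$-regularized ERM algorithm for $R$: there is a function $W:\mathcal H\to\mathbb R_{\ge0}$ such that for all $N\ge1$ and $S=(z_1,\dots,z_N)\in(\mathcal X\times\mathcal Y)^N$, with $\mu_S=\frac1N\sum_i\delta_{z_i}$, $$R(A(S),\mu_S)+\gamma_NW(A(S))-\inf_{h\in\mathcal H}\big(R(h,\mu_S)+\gamma_NW(h)\big)\le c_N .$$ 2. For every $\mu\in\mathcal P_{Lip}$: (a) $A$ is consistent at $\mu$: for all $\varepsilon,\delta\in(0,1)$ there is $N_0$ such that for all $N\ge N_0$ $$(\mu^N)_*\big\{S:\ R(A(S),\mu)-\inf_{h\in\mathcal H}R(h,\mu)\le\varepsilon\big\}\ge1-\delta,$$ where $(\mu^N)_*$ is the inner measure; (b) $\mu$ has exactly one regular conditional probability measure $\mu_{\mathcal Y|\mathcal X}$ in $\mathcal H$, and for all $\varepsilon,\delta>0$ there is $N_0$ such that for all $N\ge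 N_0$ $$(\mu^N)^*\big\{S:\ d_M(A(S),\mu_{\mathcal Y|\mathcal X})>\varepsilon\big\}\le\delta,$$ where $(\mu^N)^*$ is the outer measure. -/

import Mathlib

open MeasureTheory ProbabilityTheory Filter Topology
open scoped NNReal ENNReal

namespace GaussRERM

/-! ### Reproducing kernel Hilbert spaces and kernel mean embeddings -/

/-- A real-valued kernel `k` on `Z`, seen as a `Z × Z` matrix of operators `ℝ → ℝ`, which is the
form in which Mathlib's reproducing kernel Hilbert spaces take a kernel. -/
noncomputable def kernelMatrix {Z : Type*} (k : Z → Z → ℝ) : Matrix Z Z (ℝ →L[ℝ] ℝ) :=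
  Matrix.of fun z z' => k z z' • ContinuousLinearMap.id ℝ ℝ

/-- The reproducing kernel Hilbert space `H(k)` of a positive definite symmetric kernel `k`. -/
abbrev KernelSpace {Z : Type*} (k : Z → Z → ℝ) [Fact (kernelMatrix k).PosSemidef] : Type _ :=
  RKHS.OfKernel (kernelMatrix k)

/-- The function `k_z = k(z, ·)`, as an element of `H(k)`. -/
noncomputable def kernelSection {Z : Type*} (k : Z → Z → ℝ) [Fact (kernelMatrix k).PosSemidef]
    (z : Z) : KernelSpace k :=
  RKHS.kerFun (KernelSpace k) z (1 : ℝ)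

/-- The section `kernelSection k z` really is the function `k(·, z)`. -/
theorem kernelSection_apply {Z : Type*} (k : Z → Z → ℝ) [Fact (kernelMatrix k).PosSemidef]
    (z z' : Z) : (kernelSection k z : KernelSpace k) z' = k z' z := by
  have h := RKHS.kerFun_apply (KernelSpace k) z (1 : ℝ) z'
  rw [RKHS.OfKernel.kernel_ofKernel] at h
  simpa [kernelMatrix, kernelSection] using h

/-- The reproducing inner product `⟨k_z, k_z'⟩ = k(z, z')`. -/
theorem inner_kernelSection {Z : Type*} (k : Z → Z → ℝ) [Fact (kernelMatrix k).PosSemidef]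
    (z z' : Z) : inner ℝ (kernelSection k z) (kernelSection k z') = k z z' := by
  have h := RKHS.kerFun_inner (𝕜 := ℝ) z (1 : ℝ) (kernelSection k z')
  rw [kernelSection_apply] at h
  simpa [kernelSection] using h

/-- The kernel mean embedding `M_k(μ) = ∫ k_z dμ(z)`, a Bochner integral in `H(k)`. -/
noncomputable def kernelMean {Z : Type*} [MeasurableSpace Z] (k : Z → Z → ℝ)
    [Fact (kernelMatrix k).PosSemidef] (μ : Measure Z) : KernelSpace k :=
  ∫ z, kernelSection k z ∂μ

/-- The distance `‖μ - ν‖ = ‖M_k(μ) - M_k(ν)‖` in `H(k)` between two finite measures. -/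
noncomputable def kernelDist {Z : Type*} [MeasurableSpace Z] (k : Z → Z → ℝ)
    [Fact (kernelMatrix k).PosSemidef] (μ ν : Measure Z) : ℝ :=
  ‖kernelMean k μ - kernelMean k ν‖

/-- The Gaussian kernel `exp (-σ ‖z - z'‖ ^ 2)` of a Euclidean space `E`, pulled back to `Z` along
`φ : Z → E` (restricted to `Z`, if `φ` is an inclusion). -/
noncomputable def gaussianKernel {Z E : Type*} [NormedAddCommGroup E] (σ : ℝ≥0) (φ : Z → E) :
    Z → Z → ℝ :=
  fun z z' => Real.exp (-((σ : ℝ) * ‖φ z - φ z'‖ ^ 2))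

theorem exp_eq_integral_cos {E : Type*} [NormedAddCommGroup E] [InnerProductSpace ℝ E]
    [FiniteDimensional ℝ E] [MeasurableSpace E] [BorelSpace E] (t : E) :
    Real.exp (-(‖t‖ ^ 2 / 2)) = ∫ w, Real.cos (inner ℝ w t) ∂(stdGaussian E) := by
  have h := charFun_stdGaussian t
  rw [charFun_apply] at h
  have hi : Integrable (fun w : E => Complex.exp ((inner ℝ w t : ℝ) * Complex.I))
      (stdGaussian E) := by
    refine Integrable.mono' (integrable_const (1 : ℝ)) (by fun_prop) ?_
    exact Eventually.of_forall fun w => by simp [Complex.norm_exp_ofReal_mul_I]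
  have h2 := congrArg Complex.re h
  rw [← RCLike.re_eq_complex_re, ← integral_re hi] at h2
  simp only [RCLike.re_eq_complex_re, Complex.exp_ofReal_mul_I_re] at h2
  rw [h2]
  have : (-(‖t‖ : ℂ) ^ 2 / 2) = ((-(‖t‖ ^ 2 / 2) : ℝ) : ℂ) := by push_cast; ring
  rw [this, Complex.exp_ofReal_re]

theorem gaussianKernel_eq_integral {Z E : Type*} [NormedAddCommGroup E] [InnerProductSpace ℝ E]
    [FiniteDimensional ℝ E] [MeasurableSpace E] [BorelSpace E] (σ : ℝ≥0) (φ : Z → E) (z z' : Z) :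
    gaussianKernel σ φ z z' = ∫ w, (Real.cos (inner ℝ w (Real.sqrt (2 * σ) • φ z)) *
        Real.cos (inner ℝ w (Real.sqrt (2 * σ) • φ z')) +
      Real.sin (inner ℝ w (Real.sqrt (2 * σ) • φ z)) *
        Real.sin (inner ℝ w (Real.sqrt (2 * σ) • φ z'))) ∂(stdGaussian E) := by
  have h := exp_eq_integral_cos (Real.sqrt (2 * σ) • (φ z - φ z'))
  simp only [smul_sub, inner_sub_right, Real.cos_sub] at h
  rw [← h, gaussianKernel, ← smul_sub, norm_smul, mul_pow, Real.norm_eq_abs, sq_abs,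
    Real.sq_sqrt (by positivity)]
  congr 1
  ring

/-- The Gaussian kernel is positive definite. -/
instance posSemidef_gaussianKernel {Z E : Type*} [NormedAddCommGroup E] [InnerProductSpace ℝ E]
    [FiniteDimensional ℝ E] (σ : ℝ≥0) (φ : Z → E) :
    Fact (kernelMatrix (gaussianKernel σ φ)).PosSemidef := by
  let _ : MeasurableSpace E := borel E
  have : BorelSpace E := ⟨rfl⟩
  have htfae := RKHS.posSemidef_tfae (K := kernelMatrix (gaussianKernel σ φ))
  refine ⟨(htfae.out 0 2 rfl rfl).mpr ⟨?_, fun v => ?_⟩⟩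
  · ext i j
    simp only [kernelMatrix, gaussianKernel, Matrix.conjTranspose_apply, Matrix.of_apply, star_smul,
      star_trivial, ContinuousLinearMap.star_eq_adjoint, ContinuousLinearMap.adjoint_id,
      norm_sub_rev (φ j)]
  · have hint : ∀ i ∈ v.support, ∀ j ∈ v.support, Integrable (fun w : E => v j * v i *
        (Real.cos (inner ℝ w (Real.sqrt (2 * σ) • φ j)) *
          Real.cos (inner ℝ w (Real.sqrt (2 * σ) • φ i)) +
        Real.sin (inner ℝ w (Real.sqrt (2 * σ) • φ j)) *
          Real.sin (inner ℝ w (Real.sqrt (2 * σ) • φ i)))) (stdGaussian E) := by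
      intro i _ j _
      refine Integrable.const_mul (Integrable.mono' (integrable_const (1 : ℝ)) (by fun_prop) ?_) _
      refine Eventually.of_forall fun w => ?_
      rw [← Real.cos_sub]
      exact Real.abs_cos_le_one _
    have key : (v.sum fun x w => v.sum fun x' w' =>
        inner ℝ (kernelMatrix (gaussianKernel σ φ) x' x w) w') =
        ∫ w, ((∑ i ∈ v.support, v i * Real.cos (inner ℝ w (Real.sqrt (2 * σ) • φ i))) ^ 2 +
          (∑ i ∈ v.support, v i * Real.sin (inner ℝ w (Real.sqrt (2 * σ) • φ i))) ^ 2)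
          ∂(stdGaussian E) := by
      have h1 : (v.sum fun x w => v.sum fun x' w' =>
          inner ℝ (kernelMatrix (gaussianKernel σ φ) x' x w) w') =
          ∑ i ∈ v.support, ∑ j ∈ v.support, ∫ w, v j * v i *
            (Real.cos (inner ℝ w (Real.sqrt (2 * σ) • φ j)) *
              Real.cos (inner ℝ w (Real.sqrt (2 * σ) • φ i)) +
            Real.sin (inner ℝ w (Real.sqrt (2 * σ) • φ j)) *
              Real.sin (inner ℝ w (Real.sqrt (2 * σ) • φ i))) ∂(stdGaussian E) := by
        refine Finset.sum_congr rfl fun i _ => Finset.sum_congr rfl fun j _ => ?_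
        rw [integral_const_mul, ← gaussianKernel_eq_integral]
        simp [kernelMatrix]
        ring
      rw [h1]
      rw [Finset.sum_congr rfl fun i hi => (integral_finsetSum _ (hint i hi)).symm,
        ← integral_finsetSum _ fun i hi => integrable_finsetSum _ (hint i hi)]
      congr 1
      ext w
      rw [sq, sq, Finset.sum_mul_sum, Finset.sum_mul_sum, ← Finset.sum_add_distrib]
      refine Finset.sum_congr rfl fun i _ => ?_
      rw [← Finset.sum_add_distrib]
      refine Finset.sum_congr rfl fun j _ => ?_
      ring
    rw [key]
    exact integral_nonneg fun w => by positivity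

/-! ### The setting: `X ⊆ ℝⁿ`, `Y ⊆ ℝᵐ`, and `X × Y ⊆ ℝⁿ × ℝᵐ = ℝⁿ⁺ᵐ` with the Euclidean norm -/

variable {n m : ℕ}

/-- The kernel `K₂` on `Y`: the restriction of the Gaussian kernel. -/
noncomputable abbrev kerY (σ : ℝ≥0) (Y : Set (EuclideanSpace ℝ (Fin m))) : Y → Y → ℝ :=
  gaussianKernel σ (fun y : Y => (y : EuclideanSpace ℝ (Fin m)))

/-- The kernel `K₁` on `X × Y`: the restriction of the Gaussian kernel of `ℝⁿ⁺ᵐ`, that is, of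
`ℝⁿ × ℝᵐ` with the norm `(‖x‖ ^ 2 + ‖y‖ ^ 2) ^ (1 / 2)`. -/
noncomputable abbrev kerXY (σ : ℝ≥0) (X : Set (EuclideanSpace ℝ (Fin n)))
    (Y : Set (EuclideanSpace ℝ (Fin m))) : X × Y → X × Y → ℝ :=
  gaussianKernel σ (fun z : X × Y => WithLp.toLp 2
    ((z.1 : EuclideanSpace ℝ (Fin n)), (z.2 : EuclideanSpace ℝ (Fin m))))

/-- `C_Lip(X, P(Y))`: the Markov kernels `h` from `X` to `Y` for which `x ↦ h x ∈ P(Y)` is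
Lipschitz continuous with respect to the distance that `K₂` induces on `P(Y)`. -/
def LipKernel (σ : ℝ≥0) (X : Set (EuclideanSpace ℝ (Fin n)))
    (Y : Set (EuclideanSpace ℝ (Fin m))) : Type :=
  {h : Kernel X Y // IsMarkovKernel h ∧
    ∃ L : ℝ≥0, ∀ x x' : X, kernelDist (kerY σ Y) (h x) (h x') ≤ L * dist x x'}

variable {σ : ℝ≥0} {X : Set (EuclideanSpace ℝ (Fin n))} {Y : Set (EuclideanSpace ℝ (Fin m))}

/-- The graph `Γ_h : x ↦ δ_x ⊗ h x` of `h`, a Markov kernel from `X` to `X × Y`. -/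
noncomputable def graph (h : Kernel X Y) : Kernel X (X × Y) := Kernel.id ×ₖ h

/-- `h` is a regular conditional probability measure for `μ` with respect to the projection to
`X`: `μ(A × B) = ∫_A h(x)(B) dμ_X(x)` for all measurable `A`, `B`. -/
def IsRegCondProb (h : Kernel X Y) (μ : Measure (X × Y)) : Prop :=
  ∀ (A : Set X) (B : Set Y), MeasurableSet A → MeasurableSet B →
    μ (A ×ˢ B) = ∫⁻ x in A, h x B ∂μ.fst

variable (σ X Y) in
/-- `P_Lip`: the probability measures on `X × Y` whose `X`-marginal has full support and which
have a regular conditional probability measure in `C_Lip(X, P(Y))`. -/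
def lipMeasures : Set (Measure (X × Y)) :=
  {μ | IsProbabilityMeasure μ ∧ μ.fst.support = Set.univ ∧
    ∃ h : LipKernel σ X Y, IsRegCondProb h.1 μ}

/-- The loss `R(h, μ) = ‖(Γ_h)_* μ_X - μ‖`, the norm being that of `H(K₁)`. It makes sense for every
finite measure `μ`, in particular for empirical measures. -/
noncomputable def risk (h : LipKernel σ X Y) (μ : Measure (X × Y)) : ℝ :=
  kernelDist (kerXY σ X Y) (graph h.1 ∘ₘ μ.fst) μ

/-- The estimation error `R(h, μ) - inf_{h'} R(h', μ)`. -/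
noncomputable def estimationError (μ : Measure (X × Y)) (h : LipKernel σ X Y) : ℝ :=
  risk h μ - ⨅ h' : LipKernel σ X Y, risk h' μ

/-- The metric `d_M(f, f') = sup_x (‖f(x) - f'(x)‖ + ‖Γ_f(x) - Γ_f'(x)‖)`, where the norms come from
`K₂` and `K₁`; the supremum is that of a bounded function. -/
noncomputable def distM (f f' : LipKernel σ X Y) : ℝ :=
  ⨆ x : X, (kernelDist (kerY σ Y) (f.1 x) (f'.1 x) +
    kernelDist (kerXY σ X Y) (graph f.1 x) (graph f'.1 x))

/-! ### Learning algorithms -/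

/-- The empirical measure `(1 / N) ∑ᵢ δ_{zᵢ}` of a sample of size `N`. -/
noncomputable def empiricalMeasure {Z : Type*} [MeasurableSpace Z] {N : ℕ} (S : Fin N → Z) :
    Measure Z :=
  (N : ℝ≥0∞)⁻¹ • ∑ i, Measure.dirac (S i)

variable (σ X Y) in
/-- A learning algorithm `⋃_{N ≥ 1} (X × Y)^N → C_Lip(X, P(Y))`; no measurability is asked. -/
def LearningAlgorithm : Type :=
  (N : ℕ+) → (Fin N → X × Y) → LipKernel σ X Y

/-- `A` is a `(C, Γ)`-regularized empirical risk minimizing algorithm for the loss `risk`, where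
`C = (c N)` and `Γ = (γ N)`: these are sequences as required, and for some penalty `W ≥ 0` the output
`A N S` minimizes `h ↦ R(h, μ_S) + γ N * W h` up to `c N`, for every sample `S` of every size `N`. -/
def IsRegularizedERM (c γ : ℕ+ → ℝ) (A : LearningAlgorithm σ X Y) : Prop :=
  (Antitone c ∧ ∀ N, 0 ≤ c N) ∧
  (StrictAnti γ ∧ (∀ N, 0 < γ N) ∧ Tendsto γ atTop (𝓝 0)) ∧
  ∃ W : LipKernel σ X Y → ℝ≥0, ∀ (N : ℕ+) (S : Fin N → X × Y),
    (risk (A N S) (empiricalMeasure S) + γ N * W (A N S)) -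
      (⨅ h : LipKernel σ X Y, (risk h (empiricalMeasure S) + γ N * W h)) ≤ c N

/-- The inner measure of an arbitrary set. -/
noncomputable def innerMeasure {Ω : Type*} [MeasurableSpace Ω] (μ : Measure Ω) (s : Set Ω) :
    ℝ≥0∞ :=
  ⨆ (t : Set Ω) (_ : MeasurableSet t) (_ : t ⊆ s), μ t

/-- `A` is consistent at `μ`: for `ε, δ ∈ (0, 1)` and all large `N`, the set of the samples `S` with
estimation error at most `ε` has inner `μ^N`-measure at least `1 - δ`. -/
def IsConsistentAt (A : LearningAlgorithm σ X Y) (μ : Measure (X × Y)) : Prop :=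
  ∀ ε ∈ Set.Ioo (0 : ℝ) 1, ∀ δ ∈ Set.Ioo (0 : ℝ) 1, ∃ N₀ : ℕ+, ∀ N : ℕ+, N₀ ≤ N →
    ENNReal.ofReal (1 - δ) ≤ innerMeasure (Measure.pi fun _ : Fin N => μ)
      {S | estimationError μ (A N S) ≤ ε}

end GaussRERM

namespace GaussRERM

/-! ### Kernel sections and kernel means -/

/-! The algorithm penalizes a Lipschitz constant `lipConst h`, with weights `weight N = N ^ (-1/4)`
and slack `1/N`; it returns any minimizer of the penalized empirical risk up to that slack. Let `f`
be a Lipschitz regular conditional probability of `μ`, so that its risk at `μ` is `0`.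

The penalty confines the output to a fixed Lipschitz ball. The empirical risk of `f` is the norm of
an empirical mean of a bounded centred Hilbert-valued variable. By Chebyshev it is below `weight N`
with high probability, because `N * weight N ^ 2 = √N` tends to infinity. Comparing the output with
`f`, and using `1/N ≤ weight N`, gives `lipConst (A N S) ≤ lipConst f + 2` and an empirical risk of
order `weight N`.

On such a ball, empirical and true risks are uniformly close (`risk_le_risk_add`,
`norm_integral_sub_integral_le`): after a quantization of `X`, only finitely many cell frequencies
and one kernel mean have to converge. Hence the true risk of the output is small.

Small risk on a Lipschitz ball forces uniform closeness to `f`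
(`exists_forall_kernelDist_le_of_risk_lt`). Otherwise Arzelà–Ascoli yields a nonzero continuous
limit of the differences of kernel means, annihilated by the Gaussian integral operator of `μ.fst`.
That operator is injective up to null sets since the Gaussian kernel is characteristic
(`measure_eq_of_integral_gaussianKernel_eq`), and the full support of `μ.fst` removes the null set.
Uniform closeness bounds both the risk and `distM`. -/

theorem inner_kernelSection_left {Z : Type*} (k : Z → Z → ℝ) [Fact (kernelMatrix k).PosSemidef]
    (z : Z) (F : KernelSpace k) : inner ℝ (kernelSection k z) F = F z := by
  simp [kernelSection]

section Gaussian

variable {Z E : Type*} [NormedAddCommGroup E] [InnerProductSpace ℝ E] [FiniteDimensional ℝ E]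
  (σ : ℝ≥0) (φ : Z → E)

theorem norm_kernelSection (z : Z) : ‖kernelSection (gaussianKernel σ φ) z‖ = 1 := by
  have h := inner_kernelSection (gaussianKernel σ φ) z z
  rw [real_inner_self_eq_norm_sq] at h
  simp only [gaussianKernel, sub_self, norm_zero] at h
  have h0 := norm_nonneg (kernelSection (gaussianKernel σ φ) z)
  norm_num at h
  rcases h with h | h <;> linarith

/-- The squared distance is `2 - 2k(z, z')`, and `1 - exp (-s) ≤ s`. -/
theorem norm_kernelSection_sub_le (z z' : Z) :
    ‖kernelSection (gaussianKernel σ φ) z - kernelSection (gaussianKernel σ φ) z'‖ ≤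
      Real.sqrt (2 * σ) * ‖φ z - φ z'‖ := by
  have h : ‖kernelSection (gaussianKernel σ φ) z - kernelSection (gaussianKernel σ φ) z'‖ ^ 2 ≤
      (Real.sqrt (2 * σ) * ‖φ z - φ z'‖) ^ 2 := by
    rw [norm_sub_sq_real, inner_kernelSection, norm_kernelSection, norm_kernelSection, mul_pow,
      Real.sq_sqrt (by positivity), gaussianKernel]
    have := Real.add_one_le_exp (-((σ : ℝ) * ‖φ z - φ z'‖ ^ 2))
    nlinarith
  exact (sq_le_sq₀ (norm_nonneg _) (by positivity)).mp h

theorem abs_apply_le (F : KernelSpace (gaussianKernel σ φ)) (z : Z) : |F z| ≤ ‖F‖ := by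
  rw [← inner_kernelSection_left]
  refine (abs_real_inner_le_norm _ _).trans ?_
  rw [norm_kernelSection, one_mul]

theorem abs_apply_sub_apply_le (F : KernelSpace (gaussianKernel σ φ)) (z z' : Z) :
    |F z - F z'| ≤ Real.sqrt (2 * σ) * ‖φ z - φ z'‖ * ‖F‖ := by
  rw [← inner_kernelSection_left, ← inner_kernelSection_left, ← inner_sub_left]
  exact (abs_real_inner_le_norm _ _).trans
    (mul_le_mul_of_nonneg_right (norm_kernelSection_sub_le σ φ z z') (norm_nonneg _))

theorem norm_kernelMean_le [MeasurableSpace Z] (μ : Measure Z) [IsProbabilityMeasure μ] :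
    ‖kernelMean (gaussianKernel σ φ) μ‖ ≤ 1 := by
  have := norm_integral_le_of_norm_le_const (μ := μ)
    (Eventually.of_forall fun z => (norm_kernelSection σ φ z).le)
  simpa [kernelMean] using this

variable {φ} [TopologicalSpace Z]

theorem continuous_kernelSection (hφ : Continuous φ) :
    Continuous (kernelSection (gaussianKernel σ φ)) := by
  rw [continuous_iff_continuousAt]
  intro z
  rw [ContinuousAt, tendsto_iff_norm_sub_tendsto_zero]
  have h : Tendsto (fun z' => Real.sqrt (2 * σ) * ‖φ z' - φ z‖) (𝓝 z) (𝓝 0) := by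
    have : Continuous fun z' => Real.sqrt (2 * σ) * ‖φ z' - φ z‖ := by fun_prop
    simpa using this.tendsto z
  exact squeeze_zero (fun _ => norm_nonneg _) (fun z' => norm_kernelSection_sub_le σ φ z' z) h

variable [MeasurableSpace Z] [OpensMeasurableSpace Z] [SecondCountableTopology Z]

theorem stronglyMeasurable_kernelSection (hφ : Continuous φ) :
    StronglyMeasurable (kernelSection (gaussianKernel σ φ)) :=
  (continuous_kernelSection σ hφ).stronglyMeasurable

theorem integrable_kernelSection (hφ : Continuous φ) (μ : Measure Z) [IsFiniteMeasure μ] :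
    Integrable (kernelSection (gaussianKernel σ φ)) μ :=
  Integrable.mono' (integrable_const (1 : ℝ))
    (stronglyMeasurable_kernelSection σ hφ).aestronglyMeasurable
    (Eventually.of_forall fun z => (norm_kernelSection σ φ z).le)

theorem inner_kernelMean (hφ : Continuous φ) (μ : Measure Z) [IsFiniteMeasure μ]
    (F : KernelSpace (gaussianKernel σ φ)) :
    inner ℝ (kernelMean (gaussianKernel σ φ) μ) F = ∫ z, F z ∂μ := by
  rw [real_inner_comm, kernelMean, ← integral_inner (integrable_kernelSection σ hφ μ)]
  exact integral_congr_ae (Eventually.of_forall fun z => by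
    simp only [real_inner_comm _ F, inner_kernelSection_left])

theorem kernelMean_apply (hφ : Continuous φ) (μ : Measure Z) [IsFiniteMeasure μ] (z : Z) :
    (kernelMean (gaussianKernel σ φ) μ : KernelSpace (gaussianKernel σ φ)) z =
      ∫ z', gaussianKernel σ φ z z' ∂μ := by
  rw [← inner_kernelSection_left, real_inner_comm, inner_kernelMean σ hφ]
  refine integral_congr_ae (Eventually.of_forall fun z' => ?_)
  simp only [kernelSection_apply, gaussianKernel, norm_sub_rev]

end Gaussian

/-! ### Kernel distances between measures. -/

section Gaussian

variable {Z E : Type*} [NormedAddCommGroup E] [InnerProductSpace ℝ E] [FiniteDimensional ℝ E]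
  (σ : ℝ≥0) (φ : Z → E)

theorem kernelDist_le_two [MeasurableSpace Z] (μ ν : Measure Z) [IsProbabilityMeasure μ]
    [IsProbabilityMeasure ν] : kernelDist (gaussianKernel σ φ) μ ν ≤ 2 := by
  have h1 := norm_kernelMean_le σ φ μ
  have h2 := norm_kernelMean_le σ φ ν
  have h3 := norm_sub_le (kernelMean (gaussianKernel σ φ) μ) (kernelMean (gaussianKernel σ φ) ν)
  rw [kernelDist]
  linarith

theorem abs_kernelMean_sub_apply_le [MeasurableSpace Z] (μ ν : Measure Z) (z : Z) :
    |(kernelMean (gaussianKernel σ φ) μ : KernelSpace (gaussianKernel σ φ)) z -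
      (kernelMean (gaussianKernel σ φ) ν : KernelSpace (gaussianKernel σ φ)) z| ≤
        kernelDist (gaussianKernel σ φ) μ ν := by
  have := abs_apply_le σ φ (kernelMean (gaussianKernel σ φ) μ - kernelMean (gaussianKernel σ φ) ν) z
  simpa [kernelDist] using this

variable {φ} [TopologicalSpace Z] [MeasurableSpace Z] [OpensMeasurableSpace Z]
  [SecondCountableTopology Z]

/-- If `F` is the difference of the two means, the reproducing property gives `‖F‖² = ∫ F dμ - ∫ F
dν`. Thus uniform smallness of the function `F` controls its Hilbert norm, which lets compactness
arguments run in the sup norm. -/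
theorem kernelDist_sq_le (hφ : Continuous φ) (μ ν : Measure Z) [IsProbabilityMeasure μ]
    [IsProbabilityMeasure ν] {b : ℝ}
    (h : ∀ z, |(kernelMean (gaussianKernel σ φ) μ : KernelSpace (gaussianKernel σ φ)) z -
      (kernelMean (gaussianKernel σ φ) ν : KernelSpace (gaussianKernel σ φ)) z| ≤ b) :
    kernelDist (gaussianKernel σ φ) μ ν ^ 2 ≤ 2 * b := by
  set F := kernelMean (gaussianKernel σ φ) μ - kernelMean (gaussianKernel σ φ) ν with hF
  have hb : ∀ z, ‖F z‖ ≤ b := fun z => by simpa [hF] using h z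
  have e : kernelDist (gaussianKernel σ φ) μ ν ^ 2 = ∫ z, F z ∂μ - ∫ z, F z ∂ν := by
    rw [kernelDist, ← hF, ← real_inner_self_eq_norm_sq]
    nth_rw 1 [hF]
    rw [inner_sub_left, inner_kernelMean σ hφ, inner_kernelMean σ hφ]
  have h1 := norm_integral_le_of_norm_le_const (μ := μ) (Eventually.of_forall hb)
  have h2 := norm_integral_le_of_norm_le_const (μ := ν) (Eventually.of_forall hb)
  simp only [probReal_univ, mul_one, Real.norm_eq_abs] at h1 h2
  rw [e]
  linarith [abs_le.mp h1, abs_le.mp h2]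

/-- Kernel distances are preserved by maps that preserve the kernel. -/
theorem kernelDist_map {Z' E' : Type*} [NormedAddCommGroup E'] [InnerProductSpace ℝ E']
    [FiniteDimensional ℝ E'] [TopologicalSpace Z'] [MeasurableSpace Z'] [OpensMeasurableSpace Z']
    [SecondCountableTopology Z'] {φ' : Z' → E'} (hφ : Continuous φ) (hφ' : Continuous φ')
    {f : Z → Z'} (hf : Measurable f)
    (hk : ∀ z z', gaussianKernel σ φ' (f z) (f z') = gaussianKernel σ φ z z')
    (μ ν : Measure Z) [IsFiniteMeasure μ] [IsFiniteMeasure ν] :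
    kernelDist (gaussianKernel σ φ') (μ.map f) (ν.map f) = kernelDist (gaussianKernel σ φ) μ ν := by
  -- The squared distance expands into inner products of means, which are double integrals of the
  -- kernel and hence survive a change of variables.
  have key : ∀ (μ ν : Measure Z) [IsFiniteMeasure μ] [IsFiniteMeasure ν],
      inner ℝ (kernelMean (gaussianKernel σ φ') (μ.map f))
        (kernelMean (gaussianKernel σ φ') (ν.map f)) =
      inner ℝ (kernelMean (gaussianKernel σ φ) μ) (kernelMean (gaussianKernel σ φ) ν) := by
    intro μ ν _ _
    have hms : ∀ z', Measurable fun z => gaussianKernel σ φ' z' z := fun z' => by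
      have : Continuous fun z => gaussianKernel σ φ' z' z := by
        unfold gaussianKernel
        fun_prop
      exact this.measurable
    have h1 : ∀ z, (kernelMean (gaussianKernel σ φ') (ν.map f) :
        KernelSpace (gaussianKernel σ φ')) (f z) =
        (kernelMean (gaussianKernel σ φ) ν : KernelSpace (gaussianKernel σ φ)) z := fun z => by
      rw [kernelMean_apply σ hφ, kernelMean_apply σ hφ', integral_map hf.aemeasurable
        (hms _).aestronglyMeasurable]
      simp_rw [hk]
    have hmean : StronglyMeasurable fun z => (kernelMean (gaussianKernel σ φ') (ν.map f) :
        KernelSpace (gaussianKernel σ φ')) z := by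
      simp_rw [← inner_kernelSection_left]
      exact ((continuous_kernelSection σ hφ').inner continuous_const).stronglyMeasurable
    rw [inner_kernelMean σ hφ, inner_kernelMean σ hφ', integral_map hf.aemeasurable
      hmean.aestronglyMeasurable]
    simp_rw [h1]
  have hsq : kernelDist (gaussianKernel σ φ') (μ.map f) (ν.map f) ^ 2 =
      kernelDist (gaussianKernel σ φ) μ ν ^ 2 := by
    rw [kernelDist, kernelDist, norm_sub_sq_real, norm_sub_sq_real]
    simp only [← real_inner_self_eq_norm_sq, key]
  exact (sq_eq_sq₀ (norm_nonneg _) (norm_nonneg _)).mp hsq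

end Gaussian

/-! ### The Gaussian kernel is characteristic -/

section Characteristic

instance isOpenPosMeasure_gaussianReal : (gaussianReal 0 1).IsOpenPosMeasure :=
  ((gaussianReal_absolutelyContinuous' 0 one_ne_zero)).isOpenPosMeasure

/-- A product of real Gaussians charges every nonempty open set, and this passes to its image under
a continuous surjection. It is needed to pass from almost every frequency to every frequency. -/
instance isOpenPosMeasure_stdGaussian {E : Type*} [NormedAddCommGroup E] [InnerProductSpace ℝ E]
    [FiniteDimensional ℝ E] [MeasurableSpace E] [BorelSpace E] :
    (stdGaussian E).IsOpenPosMeasure := by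
  have hc : Continuous fun x : Fin (Module.finrank ℝ E) → ℝ =>
      ∑ i, x i • stdOrthonormalBasis ℝ E i := by fun_prop
  refine hc.isOpenPosMeasure_map fun v =>
    ⟨fun i => (stdOrthonormalBasis ℝ E).repr v i, (stdOrthonormalBasis ℝ E).sum_repr v⟩

variable {Z E : Type*} [MeasurableSpace Z] [NormedAddCommGroup E] [InnerProductSpace ℝ E]
    [FiniteDimensional ℝ E] [MeasurableSpace E] [BorelSpace E]

/-- By `gaussianKernel_eq_integral` the kernel is a Gaussian mixture of `cos · cos + sin · sin`.
Fubini then turns the mutual energy of two measures into an `L²` pairing of their characteristic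
functions. -/
theorem integral_integral_gaussianKernel (σ : ℝ≥0) {φ : Z → E} (hφ : Measurable φ)
    (μ ν : Measure Z) [IsFiniteMeasure μ] [IsFiniteMeasure ν] :
    ∫ z, ∫ z', gaussianKernel σ φ z z' ∂ν ∂μ =
      ∫ w, ((∫ z, Real.cos (inner ℝ w (Real.sqrt (2 * σ) • φ z)) ∂μ) *
          (∫ z, Real.cos (inner ℝ w (Real.sqrt (2 * σ) • φ z)) ∂ν) +
        (∫ z, Real.sin (inner ℝ w (Real.sqrt (2 * σ) • φ z)) ∂μ) *
          (∫ z, Real.sin (inner ℝ w (Real.sqrt (2 * σ) • φ z)) ∂ν)) ∂(stdGaussian E) := by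
  have hk := gaussianKernel_eq_integral σ φ
  generalize Real.sqrt (2 * σ) = c at hk ⊢
  have hm1 : Measurable fun p : E × (Z × Z) => (inner ℝ p.1 (c • φ p.2.1) : ℝ) := by fun_prop
  have hm2 : Measurable fun p : E × (Z × Z) => (inner ℝ p.1 (c • φ p.2.2) : ℝ) := by fun_prop
  have hcos : Integrable (fun p : E × (Z × Z) => Real.cos (inner ℝ p.1 (c • φ p.2.1)) *
      Real.cos (inner ℝ p.1 (c • φ p.2.2)) + Real.sin (inner ℝ p.1 (c • φ p.2.1)) *
      Real.sin (inner ℝ p.1 (c • φ p.2.2))) ((stdGaussian E).prod (μ.prod ν)) := by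
    refine Integrable.mono' (integrable_const (1 : ℝ)) (by fun_prop) (Eventually.of_forall ?_)
    intro p
    rw [← Real.cos_sub]
    exact Real.abs_cos_le_one _
  have hbd : ∀ (ρ : Measure Z) [IsFiniteMeasure ρ] (w : E),
      Integrable (fun z => Real.cos (inner ℝ w (c • φ z))) ρ ∧
      Integrable (fun z => Real.sin (inner ℝ w (c • φ z))) ρ := fun ρ _ w =>
    ⟨Integrable.mono' (integrable_const (1 : ℝ)) (by fun_prop)
      (Eventually.of_forall fun z => Real.abs_cos_le_one _),
     Integrable.mono' (integrable_const (1 : ℝ)) (by fun_prop)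
      (Eventually.of_forall fun z => Real.abs_sin_le_one _)⟩
  have h1 : ∀ w, (∫ z, Real.cos (inner ℝ w (c • φ z)) ∂μ) *
        (∫ z, Real.cos (inner ℝ w (c • φ z)) ∂ν) +
      (∫ z, Real.sin (inner ℝ w (c • φ z)) ∂μ) * (∫ z, Real.sin (inner ℝ w (c • φ z)) ∂ν) =
      ∫ p : Z × Z, (Real.cos (inner ℝ w (c • φ p.1)) * Real.cos (inner ℝ w (c • φ p.2)) +
        Real.sin (inner ℝ w (c • φ p.1)) * Real.sin (inner ℝ w (c • φ p.2))) ∂(μ.prod ν) := by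
    intro w
    rw [integral_add ((hbd μ w).1.mul_prod (hbd ν w).1) ((hbd μ w).2.mul_prod (hbd ν w).2),
      ← integral_prod_mul, ← integral_prod_mul]
  have h2 : ∫ p : Z × Z, gaussianKernel σ φ p.1 p.2 ∂(μ.prod ν) =
      ∫ w, ∫ p : Z × Z, (Real.cos (inner ℝ w (c • φ p.1)) * Real.cos (inner ℝ w (c • φ p.2)) +
        Real.sin (inner ℝ w (c • φ p.1)) * Real.sin (inner ℝ w (c • φ p.2))) ∂(μ.prod ν)
        ∂(stdGaussian E) := by
    simp_rw [hk]
    exact (integral_integral_swap hcos).symm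
  have h3 : Integrable (fun p : Z × Z => gaussianKernel σ φ p.1 p.2) (μ.prod ν) := by
    simp_rw [hk]
    exact hcos.integral_prod_right
  rw [integral_congr_ae (Eventually.of_forall h1), ← h2, integral_prod _ h3]

/-- The Gaussian kernel is characteristic: a finite measure is determined by its kernel mean. -/
theorem measure_eq_of_integral_gaussianKernel_eq {σ : ℝ≥0} (hσ : 0 < σ) {φ : Z → E}
    (hφ : MeasurableEmbedding φ) (μ ν : Measure Z) [IsFiniteMeasure μ] [IsFiniteMeasure ν]
    (h : ∀ z, ∫ z', gaussianKernel σ φ z z' ∂μ = ∫ z', gaussianKernel σ φ z z' ∂ν) : μ = ν := by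
  set c := Real.sqrt (2 * σ) with hc
  have hc0 : 0 < c := Real.sqrt_pos.mpr (by positivity)
  let C : Measure Z → E → ℝ := fun ρ w => ∫ z, Real.cos (inner ℝ w (c • φ z)) ∂ρ
  let S : Measure Z → E → ℝ := fun ρ w => ∫ z, Real.sin (inner ℝ w (c • φ z)) ∂ρ
  have hφm := hφ.measurable
  have hC : ∀ (ρ : Measure Z) [IsFiniteMeasure ρ], Continuous (C ρ) := fun ρ _ => by
    refine continuous_of_dominated (bound := fun _ => 1) (fun w => by fun_prop)
      (fun w => Eventually.of_forall fun z => Real.abs_cos_le_one _) (integrable_const _)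
      (Eventually.of_forall fun z => by fun_prop)
  have hS : ∀ (ρ : Measure Z) [IsFiniteMeasure ρ], Continuous (S ρ) := fun ρ _ => by
    refine continuous_of_dominated (bound := fun _ => 1) (fun w => by fun_prop)
      (fun w => Eventually.of_forall fun z => Real.abs_sin_le_one _) (integrable_const _)
      (Eventually.of_forall fun z => by fun_prop)
  have hCb : ∀ (ρ : Measure Z) [IsFiniteMeasure ρ] w, |C ρ w| ≤ ρ.real Set.univ := fun ρ _ w => by
    have := norm_integral_le_of_norm_le_const (μ := ρ) (C := 1)
      (f := fun z => Real.cos (inner ℝ w (c • φ z)))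
      (Eventually.of_forall fun z => Real.abs_cos_le_one _)
    simpa using this
  have hSb : ∀ (ρ : Measure Z) [IsFiniteMeasure ρ] w, |S ρ w| ≤ ρ.real Set.univ := fun ρ _ w => by
    have := norm_integral_le_of_norm_le_const (μ := ρ) (C := 1)
      (f := fun z => Real.sin (inner ℝ w (c • φ z)))
      (Eventually.of_forall fun z => Real.abs_sin_le_one _)
    simpa using this
  have hi : ∀ (ρ ρ' : Measure Z) [IsFiniteMeasure ρ] [IsFiniteMeasure ρ'],
      Integrable (fun w => C ρ w * C ρ' w + S ρ w * S ρ' w) (stdGaussian E) := by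
    intro ρ ρ' _ _
    have c1 := hC ρ
    have c2 := hC ρ'
    have s1 := hS ρ
    have s2 := hS ρ'
    refine Integrable.add ?_ ?_
    · refine Integrable.mono' (integrable_const (ρ.real Set.univ * ρ'.real Set.univ))
        (by fun_prop) (Eventually.of_forall fun w => ?_)
      rw [norm_mul]
      exact mul_le_mul (hCb ρ w) (hCb ρ' w) (norm_nonneg _) measureReal_nonneg
    · refine Integrable.mono' (integrable_const (ρ.real Set.univ * ρ'.real Set.univ))
        (by fun_prop) (Eventually.of_forall fun w => ?_)
      rw [norm_mul]
      exact mul_le_mul (hSb ρ w) (hSb ρ' w) (norm_nonneg _) measureReal_nonneg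
  have hI : ∀ (ρ ρ' : Measure Z) [IsFiniteMeasure ρ] [IsFiniteMeasure ρ'],
      ∫ w, (C ρ w * C ρ' w + S ρ w * S ρ' w) ∂(stdGaussian E) =
        ∫ z, ∫ z', gaussianKernel σ φ z z' ∂ρ' ∂ρ := fun ρ ρ' _ _ =>
    (integral_integral_gaussianKernel σ hφm ρ ρ').symm
  -- The squared distance of the characteristic functions expands into four mutual energies, which
  -- cancel under the hypothesis `h`.
  have hsq : (fun w => (C μ w - C ν w) ^ 2 + (S μ w - S ν w) ^ 2) =
      ((fun w => C μ w * C μ w + S μ w * S μ w) - fun w => C μ w * C ν w + S μ w * S ν w) -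
        ((fun w => C ν w * C μ w + S ν w * S μ w) - fun w => C ν w * C ν w + S ν w * S ν w) := by
    ext w
    simp only [Pi.sub_apply]
    ring
  have hsum : ∫ w, ((C μ w - C ν w) ^ 2 + (S μ w - S ν w) ^ 2) ∂(stdGaussian E) = 0 := by
    rw [hsq, integral_sub' ((hi μ μ).sub (hi μ ν)) ((hi ν μ).sub (hi ν ν)),
      integral_sub' (hi μ μ) (hi μ ν), integral_sub' (hi ν μ) (hi ν ν), hI, hI, hI, hI]
    simp_rw [h]
    ring
  have hcont : Continuous fun w => (C μ w - C ν w) ^ 2 + (S μ w - S ν w) ^ 2 := by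
    have c1 := hC μ
    have c2 := hC ν
    have s1 := hS μ
    have s2 := hS ν
    fun_prop
  have hae : (fun w => (C μ w - C ν w) ^ 2 + (S μ w - S ν w) ^ 2) =ᵐ[stdGaussian E] 0 := by
    refine (integral_eq_zero_iff_of_nonneg (fun w => by positivity) ?_).mp hsum
    rw [hsq]
    exact ((hi μ μ).sub (hi μ ν)).sub ((hi ν μ).sub (hi ν ν))
  have hzero := hcont.ae_eq_iff_eq (stdGaussian E) continuous_zero |>.mp hae
  have hmap : μ.map φ = ν.map φ := by
    refine Measure.ext_of_charFun ?_
    ext t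
    -- The transforms `C` and `S` carry the factor `c`, so frequency `t` is read off at `c⁻¹ • t`;
    -- this is where `σ > 0` enters.
    have hz := congrFun hzero (c⁻¹ • t)
    simp only [Pi.zero_apply] at hz
    rw [add_eq_zero_iff_of_nonneg (sq_nonneg _) (sq_nonneg _), sq_eq_zero_iff, sq_eq_zero_iff,
      sub_eq_zero, sub_eq_zero] at hz
    have hchar : ∀ (ρ : Measure Z) [IsFiniteMeasure ρ],
        charFun (ρ.map φ) t = (C ρ (c⁻¹ • t) : ℂ) + (S ρ (c⁻¹ • t) : ℂ) * Complex.I := by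
      intro ρ _
      have hint : Integrable (fun z => Complex.exp ((inner ℝ (φ z) t : ℝ) * Complex.I)) ρ :=
        Integrable.mono' (integrable_const (1 : ℝ)) (by fun_prop)
          (Eventually.of_forall fun z => by simp [Complex.norm_exp_ofReal_mul_I])
      rw [charFun_apply, integral_map hφm.aemeasurable (by fun_prop)]
      have hin : ∀ z, inner ℝ (c⁻¹ • t) (c • φ z) = inner ℝ (φ z) t := fun z => by
        rw [real_inner_smul_left, real_inner_smul_right, real_inner_comm, ← mul_assoc,
          inv_mul_cancel₀ hc0.ne', one_mul]
      apply Complex.ext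
      · rw [← RCLike.re_eq_complex_re, ← integral_re hint]
        simp [C, hin, Complex.exp_ofReal_mul_I_re]
      · rw [← RCLike.im_eq_complex_im, ← integral_im hint]
        simp [S, hin, Complex.exp_ofReal_mul_I_im]
    rw [hchar, hchar, hz.1, hz.2]
  rw [← hφ.comap_map μ, hmap, hφ.comap_map ν]

end Characteristic

/-! ### A law of large numbers in Hilbert spaces -/

section LLN

variable {Z : Type*} [MeasurableSpace Z] {H : Type*} [NormedAddCommGroup H]
  [InnerProductSpace ℝ H] [CompleteSpace H]

instance isProbabilityMeasure_empiricalMeasure {N : ℕ+} (S : Fin N → Z) :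
    IsProbabilityMeasure (empiricalMeasure S) := by
  refine ⟨?_⟩
  simp [empiricalMeasure, ENNReal.inv_mul_cancel]

theorem integral_empiricalMeasure {N : ℕ} (S : Fin N → Z) {T : Z → H}
    (hT : StronglyMeasurable T) : ∫ z, T z ∂(empiricalMeasure S) = (N : ℝ)⁻¹ • ∑ i, T (S i) := by
  rw [empiricalMeasure, integral_smul_measure, integral_finsetSum_measure]
  · simp [integral_dirac' _ _ hT]
  · intro i _
    exact integrable_dirac' hT (by simp)

/-- Expanding the square, the off-diagonal terms vanish by independence and centring, which leaves
`N` diagonal terms of size at most `B ^ 2`. -/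
theorem integral_norm_sum_sq_le (μ : Measure Z) [IsProbabilityMeasure μ] {N : ℕ} {T : Z → H}
    (hT : StronglyMeasurable T) {B : ℝ} (hB : ∀ z, ‖T z‖ ≤ B) (h0 : ∫ z, T z ∂μ = 0) :
    Integrable (fun S : Fin N → Z => ‖∑ i, T (S i)‖ ^ 2) (Measure.pi fun _ => μ) ∧
    ∫ S : Fin N → Z, ‖∑ i, T (S i)‖ ^ 2 ∂(Measure.pi fun _ => μ) ≤ N * B ^ 2 := by
  have hTi : ∀ i : Fin N, StronglyMeasurable fun S : Fin N → Z => T (S i) := fun i =>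
    hT.comp_measurable (measurable_pi_apply i)
  have hint : ∀ i j : Fin N, Integrable (fun S : Fin N → Z => inner ℝ (T (S i)) (T (S j)))
      (Measure.pi fun _ => μ) := fun i j => by
    refine Integrable.mono' (integrable_const (B * B))
      ((hTi i).inner (hTi j)).aestronglyMeasurable (Eventually.of_forall fun S => ?_)
    exact (norm_inner_le_norm _ _).trans
      (mul_le_mul (hB _) (hB _) (norm_nonneg _) ((norm_nonneg _).trans (hB (S i))))
  have hexp : (fun S : Fin N → Z => ‖∑ i, T (S i)‖ ^ 2) =
      fun S => ∑ i, ∑ j, inner ℝ (T (S i)) (T (S j)) := by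
    ext S
    rw [← real_inner_self_eq_norm_sq, sum_inner]
    simp_rw [inner_sum]
  have hind := iIndepFun_pi (μ := fun _ : Fin N => μ) (X := fun _ z => z)
    (fun _ => aemeasurable_id)
  have hTint : Integrable T μ := Integrable.mono' (integrable_const B) hT.aestronglyMeasurable
    (Eventually.of_forall hB)
  have hoff : ∀ i j : Fin N, i ≠ j →
      ∫ S : Fin N → Z, inner ℝ (T (S i)) (T (S j)) ∂(Measure.pi fun _ => μ) = 0 := by
    intro i j hij
    have hmp := fun i : Fin N => measurePreserving_eval (fun _ : Fin N => μ) i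
    have := (hind.indepFun hij).integral_bilin_comp_comp (𝕜 := ℝ) (f := T) (g := T)
      (measurable_pi_apply i).aemeasurable (measurable_pi_apply j).aemeasurable
      (by rw [(hmp i).map_eq]; exact hTint) (by rw [(hmp j).map_eq]; exact hTint) (innerSL ℝ)
    have hz : ∫ S : Fin N → Z, T (S i) ∂(Measure.pi fun _ => μ) = 0 := by
      have e := integral_map (μ := Measure.pi fun _ : Fin N => μ)
        (measurable_pi_apply i).aemeasurable (f := T) hT.aestronglyMeasurable
      rw [← h0, ← e]
      exact congrArg (fun ρ => ∫ z, T z ∂ρ) (hmp i).map_eq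
    rw [hz, map_zero, zero_apply] at this
    exact this
  rw [hexp]
  refine ⟨integrable_finsetSum _ fun i _ => integrable_finsetSum _ fun j _ => hint i j, ?_⟩
  rw [integral_finsetSum _ fun i _ => integrable_finsetSum _ fun j _ => hint i j]
  have hrow : ∀ i : Fin N, ∫ S : Fin N → Z, ∑ j, inner ℝ (T (S i)) (T (S j))
      ∂(Measure.pi fun _ => μ) ≤ B ^ 2 := fun i => by
    rw [integral_finsetSum _ fun j _ => hint i j, Finset.sum_eq_single i
      (fun j _ hj => hoff i j hj.symm) (by simp)]
    refine (integral_mono (hint i i) (integrable_const (B ^ 2)) fun S => ?_).trans (by simp)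
    simp only [real_inner_self_eq_norm_sq]
    exact pow_le_pow_left₀ (norm_nonneg _) (hB _) 2
  refine (Finset.sum_le_sum fun i _ => hrow i).trans (by simp)

/-- Chebyshev's inequality for the empirical means of a bounded Hilbert space valued function. -/
theorem measure_norm_integral_empiricalMeasure_sub_ge_le (μ : Measure Z) [IsProbabilityMeasure μ]
    (N : ℕ+) {T : Z → H} (hT : StronglyMeasurable T) {B : ℝ} (hB : ∀ z, ‖T z‖ ≤ B) {t : ℝ}
    (ht : 0 < t) :
    MeasurableSet {S : Fin N → Z | t ≤ ‖∫ z, T z ∂(empiricalMeasure S) - ∫ z, T z ∂μ‖} ∧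
    (Measure.pi fun _ : Fin N => μ)
      {S | t ≤ ‖∫ z, T z ∂(empiricalMeasure S) - ∫ z, T z ∂μ‖} ≤
        ENNReal.ofReal (4 * B ^ 2 / (N * t ^ 2)) := by
  have hN : (0 : ℝ) < N := by exact_mod_cast N.pos
  set m := ∫ z, T z ∂μ with hm
  have hmB : ‖m‖ ≤ B := by
    have := norm_integral_le_of_norm_le_const (μ := μ) (Eventually.of_forall hB)
    simpa using this
  have hTint : Integrable T μ := Integrable.mono' (integrable_const B) hT.aestronglyMeasurable
    (Eventually.of_forall hB)
  have hT' : StronglyMeasurable fun z => T z - m := hT.sub stronglyMeasurable_const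
  have hTi : ∀ i : Fin N, StronglyMeasurable fun S : Fin N → Z => T (S i) - m := fun i =>
    hT'.comp_measurable (measurable_pi_apply i)
  have hsm : Measurable fun S : Fin N → Z => ‖∑ i, (T (S i) - m)‖ ^ 2 :=
    ((Finset.stronglyMeasurable_fun_sum _ fun i _ => hTi i).norm.pow 2).measurable
  -- Centring may double the bound on `T`, hence the factor `4` in the estimate.
  have key := integral_norm_sum_sq_le μ (N := N) hT'
    (B := 2 * B) (fun z => (norm_sub_le _ _).trans (by linarith [hB z]))
    (by rw [integral_sub hTint (integrable_const _)]; simp [hm])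
  have hset : {S : Fin N → Z | t ≤ ‖∫ z, T z ∂(empiricalMeasure S) - m‖} =
      {S : Fin N → Z | (N * t) ^ 2 ≤ ‖∑ i, (T (S i) - m)‖ ^ 2} := by
    ext S
    have e : ∫ z, T z ∂(empiricalMeasure S) - m = (N : ℝ)⁻¹ • ∑ i, (T (S i) - m) := by
      rw [integral_empiricalMeasure S hT, Finset.sum_sub_distrib, smul_sub]
      simp [← Nat.cast_smul_eq_nsmul ℝ, smul_smul]
    simp only [Set.mem_ofPred_eq]
    rw [e, norm_smul, norm_inv, Real.norm_of_nonneg hN.le, sq_le_sq₀ (by positivity)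
      (norm_nonneg _), inv_mul_eq_div, le_div_iff₀ hN, mul_comm]
  rw [hset]
  refine ⟨measurableSet_le measurable_const hsm, ?_⟩
  have h := mul_meas_ge_le_integral_of_nonneg (Eventually.of_forall fun S => by positivity) key.1
    ((N * t) ^ 2)
  have h2 := h.trans key.2
  rw [← ofReal_measureReal]
  refine ENNReal.ofReal_le_ofReal ?_
  rw [le_div_iff₀ (by positivity)]
  have h3 : (N : ℝ) * ((Measure.pi fun _ : Fin N => μ).real
      {S : Fin N → Z | (N * t) ^ 2 ≤ ‖∑ i, (T (S i) - m)‖ ^ 2} * (N * t ^ 2)) ≤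
      N * (4 * B ^ 2) := by nlinarith
  exact le_of_mul_le_mul_left h3 hN

end LLN

/-! ### Quantization of Lipschitz functions -/

/-- By compactness finitely many balls around a dense sequence cover the space, so projecting to the
nearest of finitely many points moves nothing by more than `η`. -/
theorem exists_simpleFunc_dist_le {Z : Type*} [MetricSpace Z] [CompactSpace Z] [MeasurableSpace Z]
    [OpensMeasurableSpace Z] [Nonempty Z] {η : ℝ} (hη : 0 < η) :
    ∃ π : SimpleFunc Z Z, ∀ z, dist (π z) z ≤ η := by
  obtain ⟨s, hs⟩ := isCompact_univ.elim_finite_subcover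
    (fun k : ℕ => Metric.ball (TopologicalSpace.denseSeq Z k) η) (fun _ => Metric.isOpen_ball)
    (fun z _ => by
      obtain ⟨k, hk⟩ := (TopologicalSpace.denseRange_denseSeq Z).exists_mem_open
        Metric.isOpen_ball ⟨z, Metric.mem_ball_self hη⟩
      exact Set.mem_iUnion.mpr ⟨k, Metric.mem_ball_comm.mp hk⟩)
  obtain ⟨N, hN⟩ := s.exists_le
  refine ⟨SimpleFunc.nearestPt (TopologicalSpace.denseSeq Z) N, fun z => ?_⟩
  obtain ⟨k, hk, hz⟩ := Set.mem_iUnion₂.mp (hs (Set.mem_univ z))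
  have h := SimpleFunc.edist_nearestPt_le (TopologicalSpace.denseSeq Z) z (hN k hk)
  rw [edist_dist, edist_dist, ENNReal.ofReal_le_ofReal_iff dist_nonneg] at h
  rw [Metric.mem_ball, dist_comm] at hz
  exact h.trans hz.le

/-- Replacing `g` by `g ∘ π` costs `L * η` in each integral, and what remains is a finite sum over
cells. The bound sees `g` only through `L` and `B`, so it is uniform over a Lipschitz ball; this
replaces a uniform law of large numbers. -/
theorem norm_integral_sub_integral_le {Z : Type*} [PseudoMetricSpace Z] [MeasurableSpace Z]
    {H : Type*} [NormedAddCommGroup H] [NormedSpace ℝ H] [CompleteSpace H]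
    (μ ν : Measure Z) [IsProbabilityMeasure μ] [IsProbabilityMeasure ν] (π : SimpleFunc Z Z) {η : ℝ}
    (hπ : ∀ z, dist (π z) z ≤ η) {g : Z → H} (hg : StronglyMeasurable g) {L B : ℝ} (hL : 0 ≤ L)
    (hLip : ∀ z z', ‖g z - g z'‖ ≤ L * dist z z') (hB : ∀ z, ‖g z‖ ≤ B) :
    ‖∫ z, g z ∂ν - ∫ z, g z ∂μ‖ ≤
      2 * (L * η) + (∑ c ∈ π.range, |ν.real (π ⁻¹' {c}) - μ.real (π ⁻¹' {c})|) * B := by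
  have hq : ∀ (ρ : Measure Z) [IsProbabilityMeasure ρ],
      ‖∫ z, g z ∂ρ - ∑ c ∈ π.range, ρ.real (π ⁻¹' {c}) • g c‖ ≤ L * η := fun ρ _ => by
    have hi : Integrable (π.map g) ρ := SimpleFunc.integrable_of_isFiniteMeasure _
    have e : ∑ c ∈ π.range, ρ.real (π ⁻¹' {c}) • g c = ∫ z, π.map g z ∂ρ := by
      have hsum : ∀ z, π.map g z = ∑ c ∈ π.range, (π ⁻¹' {c}).indicator (fun _ => g c) z := by
        intro z
        rw [Finset.sum_eq_single (π z)]
        · simp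
        · intro c _ hc
          exact Set.indicator_of_notMem (fun h => hc (by simpa using h.symm)) _
        · intro h
          exact absurd (SimpleFunc.mem_range_self _ _) h
      simp_rw [hsum]
      rw [integral_finsetSum _ fun c _ =>
        (integrable_const _).indicator (π.measurableSet_fiber c)]
      simp_rw [integral_indicator_const _ (π.measurableSet_fiber _)]
    have hgi : Integrable g ρ := Integrable.mono' (integrable_const B) hg.aestronglyMeasurable
      (Eventually.of_forall hB)
    rw [e, ← integral_sub hgi hi]
    refine (norm_integral_le_of_norm_le_const (C := L * η) (Eventually.of_forall fun z => ?_)).trans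
      (by simp)
    rw [SimpleFunc.map_apply]
    refine (hLip _ _).trans (mul_le_mul_of_nonneg_left ?_ hL)
    rw [dist_comm]
    exact hπ z
  have h3 : ‖∑ c ∈ π.range, ν.real (π ⁻¹' {c}) • g c - ∑ c ∈ π.range, μ.real (π ⁻¹' {c}) • g c‖ ≤
      (∑ c ∈ π.range, |ν.real (π ⁻¹' {c}) - μ.real (π ⁻¹' {c})|) * B := by
    rw [← Finset.sum_sub_distrib, Finset.sum_mul]
    refine norm_sum_le_of_le _ fun c _ => ?_
    rw [← sub_smul, norm_smul]
    exact mul_le_mul_of_nonneg_left (hB c) (norm_nonneg _)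
  have h1 := hq ν
  have h2 := hq μ
  rw [norm_sub_rev] at h2
  calc _ = ‖(∫ z, g z ∂ν - ∑ c ∈ π.range, ν.real (π ⁻¹' {c}) • g c) +
        (∑ c ∈ π.range, ν.real (π ⁻¹' {c}) • g c - ∑ c ∈ π.range, μ.real (π ⁻¹' {c}) • g c) +
        (∑ c ∈ π.range, μ.real (π ⁻¹' {c}) • g c - ∫ z, g z ∂μ)‖ := by congr 1; abel
    _ ≤ _ := by
      refine (norm_add₃_le).trans ?_
      linarith

/-! ### Graphs of Lipschitz Markov kernels -/

variable {n m : ℕ} {σ : ℝ≥0} {X : Set (EuclideanSpace ℝ (Fin n))}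
  {Y : Set (EuclideanSpace ℝ (Fin m))}

instance isMarkovKernel_lipKernel (h : LipKernel σ X Y) : IsMarkovKernel h.1 := h.2.1

instance isMarkovKernel_graph (h : LipKernel σ X Y) : IsMarkovKernel (graph h.1) := by
  unfold graph
  infer_instance

theorem continuous_toLp_coe : Continuous fun z : X × Y => WithLp.toLp 2
    ((z.1 : EuclideanSpace ℝ (Fin n)), (z.2 : EuclideanSpace ℝ (Fin m))) := by
  fun_prop

theorem gaussianKernel_toLp (x x' : X) (y y' : Y) : kerXY σ X Y (x, y) (x', y') =
    gaussianKernel σ (fun x : X => (x : EuclideanSpace ℝ (Fin n))) x x' * kerY σ Y y y' := by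
  simp only [gaussianKernel, ← Real.exp_add, ← WithLp.toLp_sub, WithLp.prod_norm_sq_eq_of_L2]
  congr 1
  change -((σ : ℝ) * (‖(x : EuclideanSpace ℝ (Fin n)) - x'‖ ^ 2 +
    ‖(y : EuclideanSpace ℝ (Fin m)) - y'‖ ^ 2)) = _
  ring

theorem kerXY_mk_left (x : X) (y y' : Y) : kerXY σ X Y (x, y) (x, y') = kerY σ Y y y' := by
  rw [gaussianKernel_toLp]
  simp [gaussianKernel]

theorem norm_toLp_mk_sub (x x' : X) (y : Y) :
    ‖WithLp.toLp 2 ((x : EuclideanSpace ℝ (Fin n)), (y : EuclideanSpace ℝ (Fin m))) -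
      WithLp.toLp 2 ((x' : EuclideanSpace ℝ (Fin n)), (y : EuclideanSpace ℝ (Fin m)))‖ =
    dist x x' := by
  rw [← sq_eq_sq₀ (norm_nonneg _) dist_nonneg, ← WithLp.toLp_sub, WithLp.prod_norm_sq_eq_of_L2]
  simp [Subtype.dist_eq, dist_eq_norm]

theorem graph_apply_eq_map (h : Kernel X Y) [IsSFiniteKernel h] (x : X) :
    graph h x = (h x).map (Prod.mk x) := by
  rw [graph, Kernel.prod_apply, Kernel.id_apply, Measure.dirac_prod]

/-- The inclusion `y ↦ (x, y)` preserves the Gaussian kernel. Consequently the two summands of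
`distM` are equal. -/
theorem kernelDist_graph (h f : LipKernel σ X Y) (x : X) :
    kernelDist (kerXY σ X Y) (graph h.1 x) (graph f.1 x) =
      kernelDist (kerY σ Y) (h.1 x) (f.1 x) := by
  rw [graph_apply_eq_map, graph_apply_eq_map]
  exact kernelDist_map σ continuous_subtype_val continuous_toLp_coe (by fun_prop)
    (kerXY_mk_left x) _ _

theorem norm_kernelMean_map_mk_sub_le (x x' : X) (p : Measure Y) [IsProbabilityMeasure p] :
    ‖kernelMean (kerXY σ X Y) (p.map (Prod.mk x)) -
      kernelMean (kerXY σ X Y) (p.map (Prod.mk x'))‖ ≤ Real.sqrt (2 * σ) * dist x x' := by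
  have hm : ∀ x : X, Measurable (Prod.mk x : Y → X × Y) := fun x => by fun_prop
  have hsm := stronglyMeasurable_kernelSection σ (continuous_toLp_coe (X := X) (Y := Y))
  have hi : ∀ x : X, Integrable (fun y => kernelSection (kerXY σ X Y) (x, y)) p := fun x =>
    Integrable.mono' (integrable_const (1 : ℝ))
      (hsm.comp_measurable (hm x)).aestronglyMeasurable
      (Eventually.of_forall fun y => (norm_kernelSection σ _ _).le)
  rw [kernelMean, kernelMean, integral_map (hm x).aemeasurable hsm.aestronglyMeasurable,
    integral_map (hm x').aemeasurable hsm.aestronglyMeasurable, ← integral_sub (hi x) (hi x')]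
  refine (norm_integral_le_of_norm_le_const (C := Real.sqrt (2 * σ) * dist x x')
    (Eventually.of_forall fun y => ?_)).trans (by simp)
  refine (norm_kernelSection_sub_le σ _ _ _).trans (by rw [norm_toLp_mk_sub])

/-- Moving the base point with the measure fixed costs `√(2σ)` per unit of distance; changing the
measure over a fixed base point costs `L`. -/
theorem norm_kernelMean_graph_sub_le (h : LipKernel σ X Y) {L : ℝ}
    (hL : ∀ x x' : X, kernelDist (kerY σ Y) (h.1 x) (h.1 x') ≤ L * dist x x') (x x' : X) :
    ‖kernelMean (kerXY σ X Y) (graph h.1 x) - kernelMean (kerXY σ X Y) (graph h.1 x')‖ ≤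
      (Real.sqrt (2 * σ) + L) * dist x x' := by
  have h1 := norm_kernelMean_map_mk_sub_le (σ := σ) x x' (h.1 x)
  have h2 : kernelDist (kerXY σ X Y) ((h.1 x).map (Prod.mk x')) ((h.1 x').map (Prod.mk x')) =
      kernelDist (kerY σ Y) (h.1 x) (h.1 x') :=
    kernelDist_map σ continuous_subtype_val continuous_toLp_coe (by fun_prop)
      (kerXY_mk_left x') _ _
  have h3 := norm_sub_le_norm_sub_add_norm_sub
    (kernelMean (kerXY σ X Y) ((h.1 x).map (Prod.mk x)))
    (kernelMean (kerXY σ X Y) ((h.1 x).map (Prod.mk x')))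
    (kernelMean (kerXY σ X Y) ((h.1 x').map (Prod.mk x')))
  rw [kernelDist] at h2
  rw [graph_apply_eq_map, graph_apply_eq_map, add_mul]
  linarith [hL x x']

theorem continuous_kernelMean_graph (h : LipKernel σ X Y) :
    Continuous fun x => kernelMean (kerXY σ X Y) (graph h.1 x) := by
  obtain ⟨L, hL⟩ := h.2.2
  refine (LipschitzWith.of_dist_le_mul (K := NNReal.sqrt (2 * σ) + L) fun x x' => ?_).continuous
  rw [dist_eq_norm]
  simpa using norm_kernelMean_graph_sub_le h hL x x'

theorem continuous_kernelMean (h : LipKernel σ X Y) :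
    Continuous fun x => kernelMean (kerY σ Y) (h.1 x) := by
  obtain ⟨L, hL⟩ := h.2.2
  refine (LipschitzWith.of_dist_le_mul (K := L) fun x x' => ?_).continuous
  rw [dist_eq_norm]
  exact hL x x'

theorem kernelMean_compProd (h : LipKernel σ X Y) (ρ : Measure X) [IsFiniteMeasure ρ] :
    kernelMean (kerXY σ X Y) (ρ ⊗ₘ h.1) = ∫ x, kernelMean (kerXY σ X Y) (graph h.1 x) ∂ρ := by
  have hsm := stronglyMeasurable_kernelSection σ (continuous_toLp_coe (X := X) (Y := Y))
  rw [kernelMean, Measure.integral_compProd (integrable_kernelSection σ continuous_toLp_coe _)]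
  refine integral_congr_ae (Eventually.of_forall fun x => ?_)
  simp only
  rw [graph_apply_eq_map, kernelMean, integral_map (by fun_prop) hsm.aestronglyMeasurable]

theorem graph_comp_eq_compProd (h : LipKernel σ X Y) (ρ : Measure X) [SFinite ρ] :
    graph h.1 ∘ₘ ρ = ρ ⊗ₘ h.1 := (Measure.compProd_eq_comp_prod ρ h.1).symm

theorem eq_compProd_of_isRegCondProb (h : LipKernel σ X Y) {μ : Measure (X × Y)}
    [IsProbabilityMeasure μ] (hμ : IsRegCondProb h.1 μ) : μ = μ.fst ⊗ₘ h.1 := by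
  refine Measure.ext_prod fun {s t} hs ht => ?_
  rw [Measure.compProd_apply_prod hs ht, hμ s t hs ht]

theorem risk_eq (h : LipKernel σ X Y) (μ : Measure (X × Y)) [IsProbabilityMeasure μ] :
    risk h μ = ‖∫ x, kernelMean (kerXY σ X Y) (graph h.1 x) ∂μ.fst -
      kernelMean (kerXY σ X Y) μ‖ := by
  rw [risk, kernelDist, graph_comp_eq_compProd, kernelMean_compProd]

theorem risk_nonneg (h : LipKernel σ X Y) (μ : Measure (X × Y)) : 0 ≤ risk h μ := norm_nonneg _

/-- The integrand of which the risk is the norm of the mean. -/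
noncomputable def residual (h : LipKernel σ X Y) (z : X × Y) : KernelSpace (kerXY σ X Y) :=
  kernelMean (kerXY σ X Y) (graph h.1 z.1) - kernelSection (kerXY σ X Y) z

theorem norm_kernelMean_graph_le (h : LipKernel σ X Y) (x : X) :
    ‖kernelMean (kerXY σ X Y) (graph h.1 x)‖ ≤ 1 := norm_kernelMean_le σ _ _

theorem norm_residual_le (h : LipKernel σ X Y) (z : X × Y) : ‖residual h z‖ ≤ 2 := by
  refine (norm_sub_le _ _).trans ?_
  have h1 := norm_kernelMean_graph_le h z.1
  have h2 := norm_kernelSection σ (fun z : X × Y => WithLp.toLp 2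
    ((z.1 : EuclideanSpace ℝ (Fin n)), (z.2 : EuclideanSpace ℝ (Fin m)))) z
  linarith

theorem stronglyMeasurable_residual (h : LipKernel σ X Y) : StronglyMeasurable (residual h) :=
  (((continuous_kernelMean_graph h).comp continuous_fst).sub
    (continuous_kernelSection σ continuous_toLp_coe)).stronglyMeasurable

theorem risk_eq_norm_integral_residual (h : LipKernel σ X Y) (μ : Measure (X × Y))
    [IsProbabilityMeasure μ] : risk h μ = ‖∫ z, residual h z ∂μ‖ := by
  have hc : StronglyMeasurable fun x => kernelMean (kerXY σ X Y) (graph h.1 x) :=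
    (continuous_kernelMean_graph h).stronglyMeasurable
  have hi : Integrable (fun z : X × Y => kernelMean (kerXY σ X Y) (graph h.1 z.1)) μ :=
    Integrable.mono' (integrable_const (1 : ℝ))
      (hc.comp_measurable measurable_fst).aestronglyMeasurable
      (Eventually.of_forall fun z => norm_kernelMean_graph_le h z.1)
  rw [risk_eq, Measure.fst, integral_map (by fun_prop) hc.aestronglyMeasurable, kernelMean,
    ← integral_sub hi (integrable_kernelSection σ continuous_toLp_coe μ)]
  rfl

theorem risk_eq_zero_of_isRegCondProb (h : LipKernel σ X Y) {μ : Measure (X × Y)}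
    [IsProbabilityMeasure μ] (hμ : IsRegCondProb h.1 μ) : risk h μ = 0 := by
  rw [risk, graph_comp_eq_compProd, ← eq_compProd_of_isRegCondProb h hμ, kernelDist, sub_self,
    norm_zero]

theorem risk_le_of_isRegCondProb (h f : LipKernel σ X Y) {μ : Measure (X × Y)}
    [IsProbabilityMeasure μ] (hμ : IsRegCondProb f.1 μ) {ε : ℝ}
    (hε : ∀ x, kernelDist (kerY σ Y) (h.1 x) (f.1 x) ≤ ε) : risk h μ ≤ ε := by
  have hi : ∀ g : LipKernel σ X Y,
      Integrable (fun x => kernelMean (kerXY σ X Y) (graph g.1 x)) μ.fst := fun g =>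
    Integrable.mono' (integrable_const (1 : ℝ))
      (continuous_kernelMean_graph g).stronglyMeasurable.aestronglyMeasurable
      (Eventually.of_forall fun x => norm_kernelMean_graph_le g x)
  have h0 := risk_eq_zero_of_isRegCondProb f hμ
  rw [risk_eq, norm_eq_zero, sub_eq_zero] at h0
  rw [risk_eq, ← h0, ← integral_sub (hi h) (hi f)]
  refine (norm_integral_le_of_norm_le_const (C := ε) (Eventually.of_forall fun x => ?_)).trans
    (by simp)
  exact (kernelDist_graph h f x).trans_le (hε x)

theorem distM_le (h f : LipKernel σ X Y) {ε : ℝ} (h0 : 0 ≤ ε)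
    (hε : ∀ x, kernelDist (kerY σ Y) (h.1 x) (f.1 x) ≤ ε) : distM h f ≤ 2 * ε := by
  -- Nonnegativity of the bound covers an empty `X`, where the supremum is `0` by convention.
  refine Real.iSup_le (fun x => ?_) (by positivity)
  rw [kernelDist_graph]
  linarith [hε x]

/-- Deviation of the risk between two measures. -/
theorem risk_le_risk_add (h : LipKernel σ X Y) (μ ν : Measure (X × Y)) [IsProbabilityMeasure μ]
    [IsProbabilityMeasure ν] :
    risk h μ ≤ risk h ν + ‖∫ z, kernelSection (kerXY σ X Y) z ∂ν -
        ∫ z, kernelSection (kerXY σ X Y) z ∂μ‖ +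
      ‖∫ x, kernelMean (kerXY σ X Y) (graph h.1 x) ∂ν.fst -
        ∫ x, kernelMean (kerXY σ X Y) (graph h.1 x) ∂μ.fst‖ := by
  rw [risk_eq, risk_eq, kernelMean, kernelMean]
  set a := ∫ x, kernelMean (kerXY σ X Y) (graph h.1 x) ∂ν.fst
  set b := ∫ x, kernelMean (kerXY σ X Y) (graph h.1 x) ∂μ.fst
  set c := ∫ z, kernelSection (kerXY σ X Y) z ∂ν
  set d := ∫ z, kernelSection (kerXY σ X Y) z ∂μ
  calc ‖b - d‖ = ‖(a - c) + (c - d) + -(a - b)‖ := by congr 1; abel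
    _ ≤ _ := (norm_add₃_le).trans (by rw [norm_neg])

/-! ### Uniqueness of Lipschitz regular conditional probabilities -/

/-- The finite measures with densities `g⁺` and `g⁻` have the same kernel integrals, so they
coincide because the kernel is characteristic. -/
theorem ae_eq_zero_of_integral_gaussianKernel_mul_eq_zero {Z E : Type*} [MeasurableSpace Z]
    [NormedAddCommGroup E] [InnerProductSpace ℝ E] [FiniteDimensional ℝ E] [MeasurableSpace E]
    [BorelSpace E] {σ : ℝ≥0} (hσ : 0 < σ) {φ : Z → E} (hφ : MeasurableEmbedding φ)
    (ρ : Measure Z) [IsFiniteMeasure ρ] {g : Z → ℝ} (hg : Measurable g) {B : ℝ}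
    (hB : ∀ z, |g z| ≤ B) (h : ∀ z, ∫ z', gaussianKernel σ φ z z' * g z' ∂ρ = 0) : g =ᵐ[ρ] 0 := by
  have hfin : ∀ g : Z → ℝ, (∀ z, |g z| ≤ B) → ∫⁻ z, ENNReal.ofReal (g z) ∂ρ ≠ ∞ := by
    intro g hB
    refine ((lintegral_mono fun z => ENNReal.ofReal_le_ofReal
      ((le_abs_self _).trans (hB z))).trans_lt ?_).ne
    rw [lintegral_const]
    exact ENNReal.mul_lt_top ENNReal.ofReal_lt_top (measure_lt_top _ _)
  have hBn : ∀ z, |-g z| ≤ B := fun z => by rw [abs_neg]; exact hB z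
  have := isFiniteMeasure_withDensity (hfin g hB)
  have := isFiniteMeasure_withDensity (hfin (fun z => -g z) hBn)
  have hφm := hφ.measurable
  have hk : ∀ z, Measurable fun z' => gaussianKernel σ φ z z' := fun z => by
    unfold gaussianKernel
    fun_prop
  have hk1 : ∀ z z', |gaussianKernel σ φ z z'| ≤ 1 := fun z z' => by
    rw [gaussianKernel, Real.abs_exp, Real.exp_le_one_iff, neg_nonpos]
    positivity
  have hint : ∀ (g : Z → ℝ), Measurable g → (∀ z, |g z| ≤ B) → ∀ z,
      Integrable (fun z' => (ENNReal.ofReal (g z')).toReal * gaussianKernel σ φ z z') ρ := by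
    intro g hg hB z
    have hkz := hk z
    refine Integrable.mono' (integrable_const B) (by fun_prop) (Eventually.of_forall fun z' => ?_)
    have h0 : 0 ≤ B := (abs_nonneg _).trans (hB z')
    rw [norm_mul, ENNReal.toReal_ofReal', Real.norm_of_nonneg (le_max_right _ _), ← mul_one B]
    exact mul_le_mul (max_le ((le_abs_self _).trans (hB z')) h0) (hk1 z z') (norm_nonneg _) h0
  have heq : ρ.withDensity (fun z => ENNReal.ofReal (g z)) =
      ρ.withDensity fun z => ENNReal.ofReal (-g z) := by
    refine measure_eq_of_integral_gaussianKernel_eq hσ hφ _ _ fun z => ?_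
    rw [integral_withDensity_eq_integral_toReal_smul (by fun_prop)
      (Eventually.of_forall fun _ => ENNReal.ofReal_lt_top),
      integral_withDensity_eq_integral_toReal_smul (by fun_prop)
      (Eventually.of_forall fun _ => ENNReal.ofReal_lt_top), ← sub_eq_zero]
    simp only [smul_eq_mul]
    rw [← integral_sub (hint g hg hB z) (hint (fun z => -g z) hg.neg hBn z), ← h z]
    refine integral_congr_ae (Eventually.of_forall fun z' => ?_)
    simp only [ENNReal.toReal_ofReal']
    rw [← sub_mul, mul_comm]
    congr 1
    exact max_zero_sub_max_neg_zero_eq_self (g z')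
  have hae := (withDensity_eq_iff (by fun_prop) (by fun_prop) (hfin g hB)).mp heq
  filter_upwards [hae] with z hz
  have hz' := congrArg ENNReal.toReal hz
  rw [ENNReal.toReal_ofReal', ENNReal.toReal_ofReal'] at hz'
  rw [← max_zero_sub_max_neg_zero_eq_self (g z), hz', sub_self]
  rfl

/-- The coincidence set is closed and of full measure, so it contains the support. -/
theorem eq_of_ae_eq_of_support_eq_univ {Z F : Type*} [TopologicalSpace Z] [MeasurableSpace Z]
    [TopologicalSpace F] [T2Space F] {ρ : Measure Z} (hρ : ρ.support = Set.univ) {g g' : Z → F}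
    (hg : Continuous g) (hg' : Continuous g') (h : g =ᵐ[ρ] g') : g = g' := by
  have hcl : IsClosed {z | g z = g' z} := isClosed_eq hg hg'
  have := Measure.support_subset_of_isClosed hcl h
  rw [hρ] at this
  exact funext fun z => this (Set.mem_univ z)

theorem eq_of_kernelMean_eq (hσ : 0 < σ) (hY : MeasurableSet Y) (p q : Measure Y)
    [IsFiniteMeasure p] [IsFiniteMeasure q]
    (h : kernelMean (kerY σ Y) p = kernelMean (kerY σ Y) q) : p = q := by
  refine measure_eq_of_integral_gaussianKernel_eq hσ (MeasurableEmbedding.subtype_coe hY) p q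
    fun z => ?_
  rw [← kernelMean_apply σ continuous_subtype_val, ← kernelMean_apply σ continuous_subtype_val, h]

theorem eq_of_isRegCondProb (hσ : 0 < σ) (hY : MeasurableSet Y) {μ : Measure (X × Y)}
    [IsProbabilityMeasure μ] (hμ : μ.fst.support = Set.univ) (f g : LipKernel σ X Y)
    (hf : IsRegCondProb f.1 μ) (hg : IsRegCondProb g.1 μ) : g = f := by
  have hae : g.1 =ᵐ[μ.fst] f.1 := Kernel.ae_eq_of_compProd_eq
    ((eq_compProd_of_isRegCondProb g hg).symm.trans (eq_compProd_of_isRegCondProb f hf))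
  have h := eq_of_ae_eq_of_support_eq_univ hμ (continuous_kernelMean g) (continuous_kernelMean f)
    (hae.fun_comp (kernelMean (kerY σ Y)))
  exact Subtype.ext (Kernel.ext fun x => eq_of_kernelMean_eq hσ hY _ _ (congrFun h x))

/-! ### Stability: a small risk forces closeness to the regular conditional probability -/

/-- The kernel on `X × Y` is a product of Gaussians, so integrating over `Y` first leaves a Gaussian
integral operator on `X`. -/
theorem kernelMean_compProd_apply (h : LipKernel σ X Y) (ρ : Measure X) [IsFiniteMeasure ρ]
    (x' : X) (y' : Y) :
    (kernelMean (kerXY σ X Y) (ρ ⊗ₘ h.1) : KernelSpace (kerXY σ X Y)) (x', y') =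
      ∫ x, gaussianKernel σ (fun x : X => (x : EuclideanSpace ℝ (Fin n))) x' x *
        (kernelMean (kerY σ Y) (h.1 x) : KernelSpace (kerY σ Y)) y' ∂ρ := by
  have hi : Integrable (fun z => kerXY σ X Y (x', y') z) (ρ ⊗ₘ h.1) := by
    have := (integrable_kernelSection σ (continuous_toLp_coe (X := X) (Y := Y))
      (ρ ⊗ₘ h.1)).const_inner (𝕜 := ℝ) (kernelSection (kerXY σ X Y) (x', y'))
    simpa only [inner_kernelSection] using this
  rw [kernelMean_apply σ continuous_toLp_coe, Measure.integral_compProd hi]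
  refine integral_congr_ae (Eventually.of_forall fun x => ?_)
  simp only
  simp_rw [gaussianKernel_toLp]
  rw [integral_const_mul, kernelMean_apply σ continuous_subtype_val]

/-- The difference of the kernel means of `h x` and `f x`, evaluated at `y`. -/
noncomputable def meanDiff (h f : LipKernel σ X Y) (z : X × Y) : ℝ :=
  (kernelMean (kerY σ Y) (h.1 z.1) - kernelMean (kerY σ Y) (f.1 z.1) :
    KernelSpace (kerY σ Y)) z.2

theorem abs_meanDiff_le (h f : LipKernel σ X Y) (z : X × Y) : |meanDiff h f z| ≤ 2 :=
  (abs_apply_le σ _ _ z.2).trans (kernelDist_le_two σ _ (h.1 z.1) (f.1 z.1))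

/-- The constant depends on `h` and `f` only through `L` and `L'`, which provides the equicontinuity
for Arzelà–Ascoli. The factor `2` bounds the kernel distance of two probability measures. -/
theorem lipschitzWith_meanDiff (h f : LipKernel σ X Y) {L L' : ℝ≥0}
    (hL : ∀ x x' : X, kernelDist (kerY σ Y) (h.1 x) (h.1 x') ≤ L * dist x x')
    (hL' : ∀ x x' : X, kernelDist (kerY σ Y) (f.1 x) (f.1 x') ≤ L' * dist x x') :
    LipschitzWith (L + L' + NNReal.sqrt (2 * σ) * 2) (meanDiff h f) := by
  refine LipschitzWith.of_dist_le_mul fun z z' => ?_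
  rw [Real.dist_eq]
  have h1 : |meanDiff h f z - meanDiff h f (z'.1, z.2)| ≤ (L + L') * dist z.1 z'.1 := by
    have h3 := hL z.1 z'.1
    have h4 := hL' z.1 z'.1
    have h1 := abs_kernelMean_sub_apply_le σ (fun y : Y => (y : EuclideanSpace ℝ (Fin m)))
      (h.1 z.1) (h.1 z'.1) z.2
    have h2 := abs_kernelMean_sub_apply_le σ (fun y : Y => (y : EuclideanSpace ℝ (Fin m)))
      (f.1 z.1) (f.1 z'.1) z.2
    simp only [meanDiff, RKHS.coe_sub, Pi.sub_apply]
    rw [abs_le] at h1 h2 ⊢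
    constructor <;> linarith
  have h2 : |meanDiff h f (z'.1, z.2) - meanDiff h f z'| ≤
      Real.sqrt (2 * σ) * dist z.2 z'.2 * 2 := by
    have h2 := kernelDist_le_two σ (fun y : Y => (y : EuclideanSpace ℝ (Fin m)))
      (h.1 z'.1) (f.1 z'.1)
    refine (abs_apply_sub_apply_le σ _ _ z.2 z'.2).trans ?_
    rw [Subtype.dist_eq, dist_eq_norm]
    exact mul_le_mul_of_nonneg_left h2 (by positivity)
  have h3 : dist z.1 z'.1 ≤ dist z z' := le_max_left _ _
  have h4 : dist z.2 z'.2 ≤ dist z z' := le_max_right _ _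
  have h5 := abs_sub_le (meanDiff h f z) (meanDiff h f (z'.1, z.2)) (meanDiff h f z')
  have h6 : (L + L' : ℝ) * dist z.1 z'.1 ≤ (L + L') * dist z z' := by gcongr
  have h7 : Real.sqrt (2 * σ) * dist z.2 z'.2 * 2 ≤ Real.sqrt (2 * σ) * dist z z' * 2 := by gcongr
  push_cast
  linarith

/-- Since `μ = μ.fst ⊗ₘ f`, the integral is the value at `(x', y')` of the element of the Hilbert
space whose norm is the risk, and evaluation has norm at most one. -/
theorem abs_integral_meanDiff_le_risk (h f : LipKernel σ X Y) {μ : Measure (X × Y)}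
    [IsProbabilityMeasure μ] (hμ : IsRegCondProb f.1 μ) (x' : X) (y' : Y) :
    |∫ x, gaussianKernel σ (fun x : X => (x : EuclideanSpace ℝ (Fin n))) x' x *
      meanDiff h f (x, y') ∂μ.fst| ≤ risk h μ := by
  have hc : ∀ g : LipKernel σ X Y, Integrable (fun x =>
      gaussianKernel σ (fun x : X => (x : EuclideanSpace ℝ (Fin n))) x' x *
        (kernelMean (kerY σ Y) (g.1 x) : KernelSpace (kerY σ Y)) y') μ.fst := fun g => by
    have h1 : Continuous fun x =>
        (kernelMean (kerY σ Y) (g.1 x) : KernelSpace (kerY σ Y)) y' := by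
      simp_rw [← inner_kernelSection_left]
      exact continuous_const.inner (continuous_kernelMean g)
    have h2 : Continuous fun x => gaussianKernel σ
        (fun x : X => (x : EuclideanSpace ℝ (Fin n))) x' x := by
      unfold gaussianKernel
      fun_prop
    refine Integrable.mono' (integrable_const (1 : ℝ))
      (h2.mul h1).stronglyMeasurable.aestronglyMeasurable (Eventually.of_forall fun x => ?_)
    rw [norm_mul, ← mul_one (1 : ℝ)]
    refine mul_le_mul ?_ ((abs_apply_le σ _ _ y').trans (norm_kernelMean_le σ _ _))
      (norm_nonneg _) zero_le_one
    rw [gaussianKernel, Real.norm_eq_abs, Real.abs_exp, Real.exp_le_one_iff, neg_nonpos]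
    positivity
  simp only [meanDiff, RKHS.coe_sub, Pi.sub_apply, mul_sub]
  rw [integral_sub (hc h) (hc f), ← kernelMean_compProd_apply, ← kernelMean_compProd_apply,
    ← eq_compProd_of_isRegCondProb f hμ, risk, graph_comp_eq_compProd]
  exact abs_kernelMean_sub_apply_le σ _ _ _ _

open scoped BoundedContinuousFunction in
-- Argument by compactness: counterexamples with risk tending to `0` would have mean differences
-- converging uniformly, along a subsequence, to a function that must vanish but stays away from `0`
-- in norm.
theorem exists_forall_kernelDist_le_of_risk_lt (hσ : 0 < σ) (hX : IsCompact X) (hY : IsCompact Y)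
    {μ : Measure (X × Y)} [IsProbabilityMeasure μ] (hμ : μ.fst.support = Set.univ)
    (f : LipKernel σ X Y) (hf : IsRegCondProb f.1 μ) (L : ℝ≥0) {ε : ℝ} (hε : 0 < ε) :
    ∃ η > 0, ∀ h : LipKernel σ X Y,
      (∀ x x' : X, kernelDist (kerY σ Y) (h.1 x) (h.1 x') ≤ L * dist x x') → risk h μ < η →
      ∀ x, kernelDist (kerY σ Y) (h.1 x) (f.1 x) ≤ ε := by
  have := isCompact_iff_compactSpace.mp hX
  have := isCompact_iff_compactSpace.mp hY
  obtain ⟨L', hL'⟩ := f.2.2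
  by_contra! hcon
  choose h hL hr x hx using fun k : ℕ => hcon (1 / ((k : ℝ) + 1)) (by positivity)
  have hlip := fun k => lipschitzWith_meanDiff (h k) f (hL k) hL'
  let G : ℕ → X × Y →ᵇ ℝ := fun k =>
    BoundedContinuousFunction.mkOfCompact ⟨meanDiff (h k) f, (hlip k).continuous⟩
  have hGapp : ∀ k z, G k z = meanDiff (h k) f z := fun k z => rfl
  have hcpt : IsCompact (closure (Set.range G)) := by
    refine BoundedContinuousFunction.arzela_ascoli (Set.Icc (-2) 2) isCompact_Icc _ ?_ ?_
    · rintro _ z ⟨k, rfl⟩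
      exact abs_le.mp (abs_meanDiff_le (h k) f z)
    · refine (LipschitzWith.uniformEquicontinuous _
        (L + L' + NNReal.sqrt (2 * σ) * 2) ?_).equicontinuous
      rintro ⟨_, k, rfl⟩
      exact hlip k
  -- `kernelDist_sq_le` bounds the squared kernel distance at `x k`, which exceeds `ε ^ 2`, by `2 *
  -- ‖G k‖`.
  have hnorm : ∀ k, ε ^ 2 / 2 ≤ ‖G k‖ := fun k => by
    by_contra! hlt
    have h1 := kernelDist_sq_le σ continuous_subtype_val ((h k).1 (x k)) (f.1 (x k))
      (b := ‖G k‖) (fun y => by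
        have := (G k).norm_coe_le_norm (x k, y)
        simpa [hGapp, meanDiff] using this)
    have h2 := pow_lt_pow_left₀ (hx k) hε.le two_ne_zero
    linarith
  obtain ⟨g, -, φ, hφ, hg⟩ := hcpt.tendsto_subseq fun k => subset_closure (Set.mem_range_self k)
  have hgnorm : ε ^ 2 / 2 ≤ ‖g‖ :=
    ge_of_tendsto hg.norm (Eventually.of_forall fun k => hnorm (φ k))
  have happ : ∀ z, Tendsto (fun k => G (φ k) z) atTop (𝓝 (g z)) := fun z =>
    ((continuous_eval_const (F := X × Y →ᵇ ℝ) z).tendsto g).comp hg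
  have hgB : ∀ z, |g z| ≤ 2 := fun z => le_of_tendsto (happ z).abs
    (Eventually.of_forall fun k => abs_meanDiff_le (h (φ k)) f z)
  have hzero : ∀ y' : Y, ∀ x' : X, ∫ x, gaussianKernel σ
      (fun x : X => (x : EuclideanSpace ℝ (Fin n))) x' x * g (x, y') ∂μ.fst = 0 := by
    intro y' x'
    have hkc : Continuous fun x => gaussianKernel σ
        (fun x : X => (x : EuclideanSpace ℝ (Fin n))) x' x := by
      unfold gaussianKernel
      fun_prop
    have ht : Tendsto (fun k => ∫ x, gaussianKernel σ
        (fun x : X => (x : EuclideanSpace ℝ (Fin n))) x' x * G (φ k) (x, y') ∂μ.fst) atTop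
        (𝓝 (∫ x, gaussianKernel σ
          (fun x : X => (x : EuclideanSpace ℝ (Fin n))) x' x * g (x, y') ∂μ.fst)) := by
      refine tendsto_integral_of_dominated_convergence (fun _ => 2) (fun k => ?_)
        (integrable_const _) (fun k => Eventually.of_forall fun x => ?_)
        (Eventually.of_forall fun x => (happ (x, y')).const_mul _)
      · have : Continuous fun x => G (φ k) (x, y') := by fun_prop
        exact (hkc.mul this).stronglyMeasurable.aestronglyMeasurable
      · rw [norm_mul, ← one_mul (2 : ℝ)]
        refine mul_le_mul ?_ (abs_meanDiff_le (h (φ k)) f (x, y')) (norm_nonneg _) zero_le_one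
        rw [gaussianKernel, Real.norm_eq_abs, Real.abs_exp, Real.exp_le_one_iff, neg_nonpos]
        positivity
    have h0 : Tendsto (fun k => ∫ x, gaussianKernel σ
        (fun x : X => (x : EuclideanSpace ℝ (Fin n))) x' x * G (φ k) (x, y') ∂μ.fst) atTop
        (𝓝 0) := by
      refine squeeze_zero_norm (fun k => ?_)
        (tendsto_one_div_add_atTop_nhds_zero_nat.comp hφ.tendsto_atTop)
      exact (abs_integral_meanDiff_le_risk (h (φ k)) f hf x' y').trans (hr (φ k)).le
    exact tendsto_nhds_unique ht h0
  -- For each fixed `y'`, injectivity of the integral operator gives `g (·, y') = 0` almost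
  -- everywhere; continuity and full support give it everywhere.
  have hg0 : g = 0 := by
    ext ⟨x, y'⟩
    have hc : Continuous fun x => g (x, y') := by fun_prop
    have := ae_eq_zero_of_integral_gaussianKernel_mul_eq_zero hσ
      (MeasurableEmbedding.subtype_coe hX.measurableSet) μ.fst hc.measurable
      (fun x => hgB (x, y')) (hzero y')
    exact congrFun (eq_of_ae_eq_of_support_eq_univ hμ hc continuous_const this) x
  rw [hg0, norm_zero] at hgnorm
  have : 0 < ε ^ 2 / 2 := by positivity
  linarith

/-! ### The regularized algorithm -/

/-- A Lipschitz constant of `h`, used as penalty. -/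
noncomputable def lipConst (h : LipKernel σ X Y) : ℝ≥0 := h.2.2.choose

theorem kernelDist_le_lipConst (h : LipKernel σ X Y) (x x' : X) :
    kernelDist (kerY σ Y) (h.1 x) (h.1 x') ≤ lipConst h * dist x x' := h.2.2.choose_spec x x'

/-- The penalty weights `N ^ (-1 / 4)`. -/
noncomputable def weight (N : ℕ+) : ℝ := (Real.sqrt (Real.sqrt N))⁻¹

theorem weight_pos (N : ℕ+) : 0 < weight N := by
  have hN : (0 : ℝ) < N := by exact_mod_cast N.pos
  unfold weight
  positivity

theorem strictAnti_weight : StrictAnti weight := fun N M h => by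
  have hN : (0 : ℝ) < N := by exact_mod_cast N.pos
  have hNM : (N : ℝ) < M := by exact_mod_cast h
  refine inv_strictAnti₀ (by positivity) ?_
  exact Real.sqrt_lt_sqrt (Real.sqrt_nonneg _) (Real.sqrt_lt_sqrt hN.le hNM)

theorem tendsto_pnat_cast : Tendsto (fun N : ℕ+ => (N : ℝ)) atTop atTop :=
  tendsto_natCast_atTop_atTop.comp tendsto_PNat_val_atTop_atTop

theorem tendsto_weight : Tendsto weight atTop (𝓝 0) :=
  tendsto_inv_atTop_zero.comp
    (Real.tendsto_sqrt_atTop.comp (Real.tendsto_sqrt_atTop.comp tendsto_pnat_cast))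

/-- This dictates the exponent `1/4`: Chebyshev at threshold `weight N` has failure probability of
order `1 / (N * weight N ^ 2)`, which must tend to `0` together with `weight N`. -/
theorem mul_weight_sq (N : ℕ+) : (N : ℝ) * weight N ^ 2 = Real.sqrt N := by
  have hN : (0 : ℝ) < N := by exact_mod_cast N.pos
  have h := Real.sqrt_pos.mpr hN
  rw [weight, inv_pow, Real.sq_sqrt h.le, ← div_eq_mul_inv, div_eq_iff h.ne',
    Real.mul_self_sqrt hN.le]

theorem inv_le_weight (N : ℕ+) : (N : ℝ)⁻¹ ≤ weight N := by
  have hN : (1 : ℝ) ≤ N := by exact_mod_cast N.pos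
  refine inv_anti₀ (by positivity) ?_
  have h : ∀ x : ℝ, 1 ≤ x → Real.sqrt x ≤ x := fun x hx =>
    Real.sqrt_le_iff.mpr ⟨by linarith, by nlinarith⟩
  exact (h _ (Real.one_le_sqrt.mpr hN)).trans (h _ hN)

theorem nonempty_lipKernel [Nonempty Y] : Nonempty (LipKernel σ X Y) := by
  obtain ⟨y⟩ := ‹Nonempty Y›
  refine ⟨Kernel.const X (Measure.dirac y), inferInstance, 0, fun x x' => ?_⟩
  simp [kernelDist]

/-- The slack `1/N` is what makes a choice possible without showing that the infimum is attained. -/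
theorem exists_approximate_minimizers [Nonempty Y] :
    ∃ A : LearningAlgorithm σ X Y, ∀ (N : ℕ+) (S : Fin N → X × Y) (h : LipKernel σ X Y),
      risk (A N S) (empiricalMeasure S) + weight N * lipConst (A N S) ≤
        risk h (empiricalMeasure S) + weight N * lipConst h + (N : ℝ)⁻¹ := by
  have := nonempty_lipKernel (σ := σ) (X := X) (Y := Y)
  have key : ∀ (N : ℕ+) (S : Fin N → X × Y), ∃ g : LipKernel σ X Y, ∀ h : LipKernel σ X Y,
      risk g (empiricalMeasure S) + weight N * lipConst g ≤
        risk h (empiricalMeasure S) + weight N * lipConst h + (N : ℝ)⁻¹ := by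
    intro N S
    have hN : (0 : ℝ) < (N : ℝ)⁻¹ := inv_pos.mpr (by exact_mod_cast N.pos)
    have hbdd : BddBelow (Set.range fun h : LipKernel σ X Y =>
        risk h (empiricalMeasure S) + weight N * lipConst h) := by
      refine ⟨0, ?_⟩
      rintro _ ⟨h, rfl⟩
      have := risk_nonneg h (empiricalMeasure S)
      have := weight_pos N
      positivity
    obtain ⟨g, hg⟩ := exists_lt_of_ciInf_lt (lt_add_of_pos_right (⨅ h : LipKernel σ X Y,
      (risk h (empiricalMeasure S) + weight N * lipConst h)) hN)
    exact ⟨g, fun h => hg.le.trans (by linarith [ciInf_le hbdd h])⟩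
  choose A hA using key
  exact ⟨A, hA⟩

/-- With high probability, approximate minimizers of the regularized empirical risk are uniformly
close to the regular conditional probability. -/
theorem exists_measurableSet_forall_kernelDist_le (hσ : 0 < σ) (hX : IsCompact X)
    (hY : IsCompact Y) {A : LearningAlgorithm σ X Y}
    (hA : ∀ (N : ℕ+) (S : Fin N → X × Y) (h : LipKernel σ X Y),
      risk (A N S) (empiricalMeasure S) + weight N * lipConst (A N S) ≤
        risk h (empiricalMeasure S) + weight N * lipConst h + (N : ℝ)⁻¹)
    {μ : Measure (X × Y)} [IsProbabilityMeasure μ] (hμ : μ.fst.support = Set.univ)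
    (f : LipKernel σ X Y) (hf : IsRegCondProb f.1 μ) {ε δ : ℝ} (hε : 0 < ε) (hδ : 0 < δ) :
    ∃ N₀ : ℕ+, ∀ N : ℕ+, N₀ ≤ N → ∃ G : Set (Fin N → X × Y), MeasurableSet G ∧
      (Measure.pi fun _ : Fin N => μ) Gᶜ ≤ ENNReal.ofReal δ ∧
      ∀ S ∈ G, ∀ x, kernelDist (kerY σ Y) ((A N S).1 x) (f.1 x) ≤ ε := by
  have := isCompact_iff_compactSpace.mp hX
  have : Nonempty X := (nonempty_of_isProbabilityMeasure μ).map Prod.fst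
  -- In `lipConst f + 2`, one unit pays for the empirical risk of `f` and one for the slack `1/N`,
  -- each at most `weight N` on the good event.
  obtain ⟨η, hη, hstab⟩ := exists_forall_kernelDist_le_of_risk_lt hσ hX hY hμ f hf
    (lipConst f + 2) hε
  set K : ℝ := Real.sqrt (2 * σ) + (lipConst f + 2 : ℝ≥0) with hK
  have hK0 : 0 < K := by
    rw [hK]
    push_cast
    positivity
  -- The mesh makes the quantization error `2 * K * (η / (8 * K)) = η / 4`; the threshold `t` below
  -- makes the errors of all cells and of the kernel mean of the sample add up to `η / 4`.
  obtain ⟨π, hπ⟩ := exists_simpleFunc_dist_le (Z := X) (η := η / (8 * K)) (by positivity)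
  set t : ℝ := η / (4 * (π.range.card + 1)) with ht
  have ht0 : 0 < t := by positivity
  have hsm := stronglyMeasurable_kernelSection σ (continuous_toLp_coe (X := X) (Y := Y))
  have hcell : ∀ c : X, MeasurableSet (Prod.fst ⁻¹' (π ⁻¹' {c}) : Set (X × Y)) := fun c =>
    measurable_fst (π.measurableSet_fiber c)
  have hind : ∀ c : X, StronglyMeasurable
      ((Prod.fst ⁻¹' (π ⁻¹' {c}) : Set (X × Y)).indicator fun _ => (1 : ℝ)) := fun c =>
    stronglyMeasurable_const.indicator (hcell c)
  have hreal : ∀ (ν : Measure (X × Y)) [IsProbabilityMeasure ν] (c : X),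
      ∫ z, (Prod.fst ⁻¹' (π ⁻¹' {c}) : Set (X × Y)).indicator (fun _ => (1 : ℝ)) z ∂ν =
        ν.fst.real (π ⁻¹' {c}) := fun ν _ c => by
    rw [integral_indicator_const _ (hcell c), smul_eq_mul, mul_one, measureReal_def,
      measureReal_def, Measure.fst_apply (π.measurableSet_fiber c)]
  have hres0 : ∫ z, residual f z ∂μ = 0 := by
    rw [← norm_eq_zero, ← risk_eq_norm_integral_residual]
    exact risk_eq_zero_of_isRegCondProb f hf
  -- These are the Chebyshev bounds for the three kinds of bad event: a large empirical risk of `f`,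
  -- a deviating kernel mean, and a deviating cell frequency (one for each cell).
  have hlim : Tendsto (fun N : ℕ+ => 4 * 2 ^ 2 / (N * weight N ^ 2) + 4 * 1 ^ 2 / (N * t ^ 2) +
      π.range.card * (4 * 1 ^ 2 / (N * t ^ 2))) atTop (𝓝 0) := by
    simp_rw [mul_weight_sq]
    have h1 : Tendsto (fun N : ℕ+ => 4 * 2 ^ 2 / Real.sqrt N) atTop (𝓝 0) :=
      (Real.tendsto_sqrt_atTop.comp tendsto_pnat_cast).const_div_atTop _
    have h2 : Tendsto (fun N : ℕ+ => 4 * 1 ^ 2 / ((N : ℝ) * t ^ 2)) atTop (𝓝 0) :=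
      (tendsto_pnat_cast.atTop_mul_const (by positivity)).const_div_atTop _
    simpa using (h1.add h2).add (h2.const_mul (π.range.card : ℝ))
  have hlim2 : Tendsto (fun N : ℕ+ => weight N * (2 + lipConst f)) atTop (𝓝 0) := by
    simpa using tendsto_weight.mul_const (2 + lipConst f : ℝ)
  obtain ⟨N₀, hN₀⟩ := eventually_atTop.mp
    ((hlim.eventually_lt_const hδ).and (hlim2.eventually_lt_const (show (0 : ℝ) < η / 4 by
      positivity)))
  refine ⟨N₀, fun N hN => ?_⟩
  obtain ⟨hb, hw⟩ := hN₀ N hN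
  have c1 := measure_norm_integral_empiricalMeasure_sub_ge_le μ N
    (stronglyMeasurable_residual f) (norm_residual_le f) (weight_pos N)
  have c2 := measure_norm_integral_empiricalMeasure_sub_ge_le μ N hsm
    (fun z => (norm_kernelSection σ _ z).le) ht0
  have c3 := fun c : X => measure_norm_integral_empiricalMeasure_sub_ge_le μ N (hind c) (B := 1)
    (fun z => by
      by_cases hz : z ∈ (Prod.fst ⁻¹' (π ⁻¹' {c}) : Set (X × Y)) <;> simp [hz]) ht0
  rw [hres0] at c1
  simp only [hreal, sub_zero] at c1 c3
  set B1 := {S : Fin N → X × Y | weight N ≤ ‖∫ z, residual f z ∂(empiricalMeasure S)‖}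
  set B2 := {S : Fin N → X × Y | t ≤ ‖∫ z, kernelSection (kerXY σ X Y) z ∂(empiricalMeasure S) -
    ∫ z, kernelSection (kerXY σ X Y) z ∂μ‖}
  set B3 := fun c : X => {S : Fin N → X × Y |
    t ≤ ‖(empiricalMeasure S).fst.real (π ⁻¹' {c}) - μ.fst.real (π ⁻¹' {c})‖}
  refine ⟨(B1 ∪ B2 ∪ ⋃ c ∈ π.range, B3 c)ᶜ, ((c1.1.union c2.1).union
    (Finset.measurableSet_biUnion _ fun c _ => (c3 c).1)).compl, ?_, ?_⟩
  · rw [compl_compl]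
    have hB3 : (Measure.pi fun _ : Fin N => μ) (⋃ c ∈ π.range, B3 c) ≤
        ENNReal.ofReal (π.range.card * (4 * 1 ^ 2 / (N * t ^ 2))) := by
      refine (measure_biUnion_finset_le _ _).trans
        ((Finset.sum_le_sum fun c _ => (c3 c).2).trans ?_)
      rw [Finset.sum_const, nsmul_eq_mul, ENNReal.ofReal_mul (by positivity),
        ENNReal.ofReal_natCast]
    have hw0 := weight_pos N
    refine (measure_union_le _ _).trans ((add_le_add (measure_union_le _ _) hB3).trans
      ((add_le_add_left (add_le_add c1.2 c2.2) _).trans ?_))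
    rw [← ENNReal.ofReal_add (by positivity) (by positivity),
      ← ENNReal.ofReal_add (by positivity) (by positivity)]
    exact ENNReal.ofReal_le_ofReal hb.le
  · intro S hS
    simp only [Set.mem_compl_iff, Set.mem_union, Set.mem_iUnion, not_or, not_exists, B1, B2, B3,
      Set.mem_ofPred_eq, not_le] at hS
    obtain ⟨⟨h1, h2⟩, h3⟩ := hS
    rw [← risk_eq_norm_integral_residual] at h1
    have hw0 := weight_pos N
    have hmin := hA N S f
    have hNw := inv_le_weight N
    have hr0 := risk_nonneg (A N S) (empiricalMeasure S)
    -- Drop the nonnegative empirical risk of the output from the comparison with `f`, then divide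
    -- by `weight N`.
    have hlip : lipConst (A N S) ≤ lipConst f + 2 := by
      have h : weight N * lipConst (A N S) ≤ weight N * (lipConst f + 2) := by linarith
      exact_mod_cast le_of_mul_le_mul_left h hw0
    have hlip' : ∀ x x' : X, kernelDist (kerY σ Y) ((A N S).1 x) ((A N S).1 x') ≤
        (lipConst f + 2 : ℝ≥0) * dist x x' := fun x x' =>
      (kernelDist_le_lipConst _ x x').trans
        (mul_le_mul_of_nonneg_right (NNReal.coe_le_coe.mpr hlip) dist_nonneg)
    refine hstab (A N S) hlip' ?_
    have hemp : risk (A N S) (empiricalMeasure S) < η / 4 := by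
      have : (0 : ℝ) ≤ weight N * lipConst (A N S) := by positivity
      linarith
    have hdev := norm_integral_sub_integral_le μ.fst (empiricalMeasure S).fst π hπ
      (continuous_kernelMean_graph (A N S)).stronglyMeasurable hK0.le
      (norm_kernelMean_graph_sub_le (A N S) hlip') (norm_kernelMean_graph_le (A N S))
    have hsum : ∑ c ∈ π.range, |(empiricalMeasure S).fst.real (π ⁻¹' {c}) -
        μ.fst.real (π ⁻¹' {c})| ≤ π.range.card * t := by
      rw [← nsmul_eq_mul]
      exact Finset.sum_le_card_nsmul _ _ _ fun c hc => (h3 c hc).le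
    have ht4 : π.range.card * t + t = η / 4 := by
      rw [ht]
      field_simp
    have hK4 : 2 * (K * (η / (8 * K))) = η / 4 := by
      field_simp
      norm_num
    -- Empirical risk, sampling errors and quantization error contribute at most `η / 4` each, so
    -- the risk at `μ` stays below `η`.
    have hrisk := risk_le_risk_add (A N S) μ (empiricalMeasure S)
    linarith

theorem le_innerMeasure {Ω : Type*} [MeasurableSpace Ω] (μ : Measure Ω) {s t : Set Ω}
    (ht : MeasurableSet t) (hts : t ⊆ s) : μ t ≤ innerMeasure μ s :=
  le_iSup₂_of_le t ht (le_iSup_of_le hts le_rfl)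

end GaussRERM
-- Assembly of the theorem.
open GaussRERM in
theorem proposition2p17 {n m : ℕ} (σ : ℝ≥0) (hσ : 0 < σ)
    (X : Set (EuclideanSpace ℝ (Fin n))) (hX : IsCompact X)
    (Y : Set (EuclideanSpace ℝ (Fin m))) (hY : IsCompact Y) :
    ∃ (c γ : ℕ+ → ℝ) (A : LearningAlgorithm σ X Y),
      IsRegularizedERM c γ A ∧ Tendsto c atTop (𝓝 0) ∧
      ∀ μ ∈ lipMeasures σ X Y,
        IsConsistentAt A μ ∧
        ∃ f : LipKernel σ X Y,
          IsRegCondProb f.1 μ ∧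
          (∀ g : LipKernel σ X Y, IsRegCondProb g.1 μ → g = f) ∧
          ∀ ε > (0 : ℝ), ∀ δ > (0 : ℝ), ∃ N₀ : ℕ+, ∀ N : ℕ+, N₀ ≤ N →
            (Measure.pi fun _ : Fin N => μ) {S | ε < distM (A N S) f} ≤ ENNReal.ofReal δ := by
  have hc : (Antitone fun N : ℕ+ => (N : ℝ)⁻¹) ∧ ∀ N : ℕ+, (0 : ℝ) ≤ (N : ℝ)⁻¹ :=
    ⟨fun N M h => inv_anti₀ (by exact_mod_cast N.pos) (by exact_mod_cast h), fun N => by positivity⟩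
  have hγ := And.intro strictAnti_weight (And.intro weight_pos tendsto_weight)
  have hc0 : Tendsto (fun N : ℕ+ => (N : ℝ)⁻¹) atTop (𝓝 0) :=
    tendsto_inv_atTop_zero.comp tendsto_pnat_cast
  -- If `Y` is empty there may be no Markov kernel to return, but since `N ≥ 1` there is no sample
  -- either, and no probability measure on `X × Y`.
  rcases isEmpty_or_nonempty Y with hYe | hYne
  · refine ⟨fun N => (N : ℝ)⁻¹, weight, fun N S => isEmptyElim (S ⟨0, N.pos⟩).2,
      ⟨hc, hγ, fun _ => 0, fun N S => isEmptyElim (S ⟨0, N.pos⟩).2⟩, hc0, fun μ hμ => ?_⟩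
    have := hμ.1
    obtain ⟨z⟩ := nonempty_of_isProbabilityMeasure μ
    exact isEmptyElim z.2
  · have hne := nonempty_lipKernel (σ := σ) (X := X) (Y := Y)
    obtain ⟨A, hA⟩ := exists_approximate_minimizers (σ := σ) (X := X) (Y := Y)
    refine ⟨fun N => (N : ℝ)⁻¹, weight, A, ⟨hc, hγ, lipConst, fun N S => ?_⟩, hc0, ?_⟩
    · rw [sub_le_iff_le_add', ← sub_le_iff_le_add]
      exact le_ciInf fun h => sub_le_iff_le_add.mpr (hA N S h)
    rintro μ ⟨hprob, hsupp, f, hf⟩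
    have key := fun ε δ hε hδ => exists_measurableSet_forall_kernelDist_le hσ hX hY hA hsupp f hf
      (ε := ε) (δ := δ) hε hδ
    refine ⟨fun ε hε δ hδ => ?_, f, hf,
      fun g hg => eq_of_isRegCondProb hσ hY.measurableSet hsupp f g hf hg, fun ε hε δ hδ => ?_⟩
    · obtain ⟨N₀, hN₀⟩ := key ε δ hε.1 hδ.1
      refine ⟨N₀, fun N hN => ?_⟩
      obtain ⟨G, hG, hGδ, hGε⟩ := hN₀ N hN
      refine le_trans ?_ (le_innerMeasure _ hG fun S hS => ?_)
      · rw [prob_compl_eq_one_sub hG] at hGδ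
        rw [ENNReal.ofReal_sub _ hδ.1.le, ENNReal.ofReal_one]
        exact tsub_le_iff_tsub_le.mp hGδ
      -- The risk itself is at most `ε`; the infimum need only be nonnegative.
      · have h1 := risk_le_of_isRegCondProb (A N S) f hf (hGε S hS)
        have h2 : (0 : ℝ) ≤ ⨅ h : LipKernel σ X Y, risk h μ := le_ciInf fun h => risk_nonneg h μ
        change risk (A N S) μ - _ ≤ ε
        linarith
    -- Half of `ε`, because `distM` counts the kernel distance twice.
    · obtain ⟨N₀, hN₀⟩ := key (ε / 2) δ (by positivity) hδ
      refine ⟨N₀, fun N hN => ?_⟩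
      obtain ⟨G, hG, hGδ, hGε⟩ := hN₀ N hN
      refine (measure_mono fun S hS hSG => ?_).trans hGδ
      have h := distM_le (A N S) f (by positivity) (hGε S hSG)
      have hS' : ε < distM (A N S) f := hS
      linarith
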